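/- Let $n\in\mathbb{N}$, $T>0$, let $H_0,H_1\in\mathfrak{su}(n)$ (traceless skew-Hermitian $n\times n$ matrices), and let $\rho_0,\theta$ be Hermitian $n\times n$ matrices. For $u\in\mathcal H:=L^2([0,T],\mathbb{R})$ let $\rho(\cdot)$ and $U(\cdot)$ be the absolutely continuous (Carathéodory) solutions on $[0,T]$ of $$\dot\rho=[H_0+u(t)H_1,\rho],\ \rho(0)=\rho_0,\qquad \dot U=(H_0+u(t)H_1)U,\ U(0)=\mathrm{Id}.$$ Put $\mathrm{End}_{\rho_0}(u):=\rho(T)$, which lies in $\mathcal O(\rho_0):=\{U\rho_0U^\dagger: U\in \mathrm{SU}(n)\}$, and $J(\rho):=\mathrm{Re}\,\mathrm{tr}(\rho\theta)$, $\mathcal J(u):=J(\mathrm{End}_{\rho_0}(u))$. For $\rho\in\mathcal O(\rho_0)$ equip the tangent space $T_\rho\mathcal O(\rho_0)=\{[\rho,\Omega]:\Omega\in\mathfrak{su}(n)\}$ with the inner product $\langle[\rho,\Omega_1],[\rho,\Omega_2]\rangle_\rho:=\mathrm{tr}\big((\Omega_1^{\mathfrak p_\rho})^\dagger\,\Omega_2^{\mathfrak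 p_\rho}\big)$, where $\Omega^{\mathfrak p_\rho}$ is the Hilbert–Schmidt orthogonal projection of $\Omega$ onto the orthogonal complement $\mathfrak p_\rho$ of $\{\Omega\in\mathfrak{su}(n):[\rho,\Omega]=0\}$ in $\mathfrak{su}(n)$. Let $\nabla J$ be the gradient of $J$ on $\mathcal O(\rho_0)$ for this metric, let $d\mathrm{End}_{\rho_0}(u):\mathcal H\to T_{\rho(T)}\mathcal O(\rho_0)$ be the Fréchet differential of $\mathrm{End}_{\rho_0}$ at $u$, and let $d\mathrm{End}^*_{\rho_0}(u)$ be its adjoint. For $z\in T_{\rho(T)}\mathcal O(\rho_0)$ let $q(\cdot)$, with $q(t)\in T_{\rho(t)}\mathcal O(\rho_0)$, be the solution on $[0,T]$ of $\dot q=[H_0+u(t)H_1,q]$, $q(T)=z$, and define the switching function $\Phi_{\rho_0,z}(t):=\langle q(t),[H_1,\rho(t)]\rangle_{\rho(t)}$. Then, for every $u\in\mathcal H$, the objects above exist and are uniquely determined by $u$ (and $z$), and the following are equivalent: 1. $u$ is a critical point of $\mathcal J$, i.e. $\mathcal J$ is differentiable at $u$ and $\nabla\mathcal J(u)=0$; 2.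 $\nabla J(\mathrm{End}_{\rho_0}(u))\in\mathrm{Ker}\,(d\mathrm{End}^*_{\rho_0}(u))$; 3. $\nabla J(\mathrm{End}_{\rho_0}(u))$ is orthogonal to the image of $d\mathrm{End}_{\rho_0}(u)$ with respect to $\langle\cdot,\cdot\rangle_{\mathrm{End}_{\rho_0}(u)}$; 4. the switching function $\Phi_{\rho_0,\nabla J(\mathrm{End}_{\rho_0}(u))}$ vanishes almost everywhere on $[0,T]$; 5. $\mathrm{tr}\big([\rho_0,U(T)^\dagger\theta U(T)]\,U(t)^\dagger H_1U(t)\big)=0$ for all $t\in[0,T]$; 6. $\mathrm{tr}\big([\rho(T),\theta]\,V(t)^\dagger H_1V(t)\big)=0$ for all $t\in[0,T]$, where $V(t):=U(t)U(T)^\dagger$ is the propagator from time $T$ to time $t$. -/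

import Mathlib

open MeasureTheory Set
open scoped Matrix ENNReal

namespace QuantumControl

/-- Complex `n × n` matrices, with their usual (entrywise) topology. -/
abbrev Mat (n : ℕ) := Matrix (Fin n) (Fin n) ℂ

/-! ### Traceless skew-Hermitian matrices and the unitary orbit -/

/-- `𝔰𝔲(n)`: traceless skew-Hermitian matrices, as a real vector space. -/
noncomputable def su (n : ℕ) : Submodule ℝ (Mat n) where
  carrier := {A | Aᴴ = -A ∧ A.trace = 0}
  add_mem' := by
    rintro A B ⟨hA, hA'⟩ ⟨hB, hB'⟩
    exact ⟨by rw [Matrix.conjTranspose_add, hA, hB, neg_add], by simp [hA', hB']⟩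
  zero_mem' := by simp
  smul_mem' := by
    rintro c A ⟨hA, hA'⟩
    exact ⟨by rw [Matrix.conjTranspose_smul, hA]; simp, by simp [hA']⟩

/-- The unitary orbit `𝒪(ρ₀) = {U ρ₀ U† : U ∈ SU(n)}`. -/
def orbit {n : ℕ} (ρ₀ : Mat n) : Set (Mat n) :=
  {ρ | ∃ U ∈ Matrix.specialUnitaryGroup (Fin n) ℂ, ρ = U * ρ₀ * Uᴴ}

/-- `ad_ρ Ω = [ρ, Ω] = ρ Ω - Ω ρ`, as a real linear map in `Ω`. -/
noncomputable def ad {n : ℕ} (ρ : Mat n) : Mat n →ₗ[ℝ] Mat n :=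
  LinearMap.mulLeft ℝ ρ - LinearMap.mulRight ℝ ρ

lemma ad_apply {n : ℕ} (ρ Ω : Mat n) : ad ρ Ω = ⁅ρ, Ω⁆ := rfl

/-- The (real) Hilbert-Schmidt form `(A, B) ↦ Re tr(A† B)`. On `𝔰𝔲(n)` the trace `tr(A† B)` is
already real. -/
noncomputable def hs (n : ℕ) : LinearMap.BilinForm ℝ (Mat n) :=
  LinearMap.mk₂ ℝ (fun A B => (Aᴴ * B).trace.re)
    (by intros; simp [add_mul]) (by intros; simp)
    (by intros; simp [mul_add]) (by intros; simp)

lemma hs_apply {n : ℕ} (A B : Mat n) : hs n A B = (Aᴴ * B).trace.re := rfl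

lemma hs_self_eq {n : ℕ} (A : Mat n) : hs n A A = ∑ i, ∑ j, Complex.normSq (A j i) := by
  simp [hs_apply, Matrix.trace, Matrix.mul_apply, Complex.normSq_apply]

lemma hs_self_nonneg {n : ℕ} (A : Mat n) : 0 ≤ hs n A A := by
  rw [hs_self_eq]
  exact Finset.sum_nonneg fun i _ => Finset.sum_nonneg fun j _ => Complex.normSq_nonneg _

lemma eq_zero_of_hs_self {n : ℕ} {A : Mat n} (h : hs n A A = 0) : A = 0 := by
  rw [hs_self_eq, Finset.sum_eq_zero_iff_of_nonneg
    (fun i _ => Finset.sum_nonneg fun j _ => Complex.normSq_nonneg _)] at h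
  ext j i
  have h1 := h i (Finset.mem_univ i)
  rw [Finset.sum_eq_zero_iff_of_nonneg (fun j _ => Complex.normSq_nonneg _)] at h1
  simpa using h1 j (Finset.mem_univ j)

lemma hs_symm {n : ℕ} (A B : Mat n) : hs n A B = hs n B A := by
  simp only [hs_apply]
  rw [← Complex.conj_re, ← Complex.star_def, ← Matrix.trace_conjTranspose,
    Matrix.conjTranspose_mul, Matrix.conjTranspose_conjTranspose]

/-- `𝔥_ρ = {Ω ∈ 𝔰𝔲(n) : [ρ, Ω] = 0}`. -/
noncomputable def stab {n : ℕ} (ρ : Mat n) : Submodule ℝ (Mat n) := su n ⊓ LinearMap.ker (ad ρ)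

/-- `𝔭_ρ`, the Hilbert-Schmidt orthogonal complement of `𝔥_ρ` in `𝔰𝔲(n)`. -/
noncomputable def pSpace {n : ℕ} (ρ : Mat n) : Submodule ℝ (Mat n) where
  carrier := {Ω | Ω ∈ su n ∧ ∀ Ω' ∈ stab ρ, hs n Ω Ω' = 0}
  add_mem' := by
    rintro A B ⟨hA, hA'⟩ ⟨hB, hB'⟩
    exact ⟨add_mem hA hB, fun Ω' h => by simp [hA' Ω' h, hB' Ω' h]⟩
  zero_mem' := ⟨zero_mem _, fun Ω' _ => by simp⟩
  smul_mem' := by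
    rintro c A ⟨hA, hA'⟩
    exact ⟨(su n).smul_mem c hA, fun Ω' h => by simp [hA' Ω' h]⟩

/-- `T_ρ 𝒪 = ad_ρ 𝔰𝔲(n)`, as a subspace of the space of matrices. -/
noncomputable def tangentSubmodule {n : ℕ} (ρ : Mat n) : Submodule ℝ (Mat n) := (su n).map (ad ρ)

/-- Equivariance `𝔭_{U ρ U†} = U 𝔭_ρ U†`: on the orbit of `ρ₀`, the spaces `𝔭_ρ` are the
translates of `𝔭_{ρ₀}`. -/
lemma conj_mem_pSpace {n : ℕ} {U : Mat n} (hU : Uᴴ * U = 1) (ρ : Mat n) {Ω : Mat n}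
    (hΩ : Ω ∈ pSpace ρ) : U * Ω * Uᴴ ∈ pSpace (U * ρ * Uᴴ) := by
  have hU' : U * Uᴴ = 1 := mul_eq_one_comm.1 hU
  have hconj : ∀ {V A : Mat n}, Vᴴ * V = 1 → A ∈ su n → V * A * Vᴴ ∈ su n := by
    rintro V A hV ⟨h1, h2⟩
    refine ⟨by simp [h1, mul_assoc], ?_⟩
    rw [Matrix.trace_mul_comm, ← mul_assoc, hV, one_mul, h2]
  refine ⟨hconj hU hΩ.1, ?_⟩
  rintro Ω' ⟨h1, h2⟩
  have h3 : Uᴴ * Ω' * U ∈ stab ρ := by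
    refine ⟨by simpa using hconj (V := Uᴴ) (by simpa using hU') h1, ?_⟩
    have h2' : U * ρ * Uᴴ * Ω' - Ω' * (U * ρ * Uᴴ) = 0 := h2
    have h4 : ρ * (Uᴴ * Ω' * U) - Uᴴ * Ω' * U * ρ
        = Uᴴ * (U * ρ * Uᴴ * Ω' - Ω' * (U * ρ * Uᴴ)) * U := by
      simp only [mul_sub, sub_mul, mul_assoc, hU, mul_one]
      simp only [← mul_assoc, hU, one_mul]
    change ρ * (Uᴴ * Ω' * U) - Uᴴ * Ω' * U * ρ = 0
    rw [h4, h2']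
    simp
  have h5 := hΩ.2 _ h3
  rw [hs_apply] at h5 ⊢
  rw [← h5]
  congr 1
  simp only [Matrix.conjTranspose_mul, Matrix.conjTranspose_conjTranspose, mul_assoc]
  rw [Matrix.trace_mul_comm]
  simp only [mul_assoc]

/-- The decomposition `Ω = Ω^𝔥 + Ω^𝔭`. -/
lemma exists_decomp {n : ℕ} (ρ : Mat n) {Ω : Mat n} (hΩ : Ω ∈ su n) :
    ∃ a ∈ stab ρ, ∃ b ∈ pSpace ρ, a + b = Ω := by
  have hnd : ((hs n).restrict (stab ρ)).Nondegenerate := by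
    refine ⟨fun x hx => ?_, fun x hx => ?_⟩ <;>
      exact Subtype.ext (eq_zero_of_hs_self (hx x))
  have hrefl : (hs n).IsRefl := fun x y h => by rw [hs_symm]; exact h
  have hc := LinearMap.BilinForm.isCompl_orthogonal_of_restrict_nondegenerate hrefl hnd
  obtain ⟨a, ha, b, hb, hab⟩ := Submodule.mem_sup.1 (hc.sup_eq_top ▸ Submodule.mem_top (x := Ω))
  refine ⟨a, ha, b, ⟨?_, fun Ω' h => ?_⟩, hab⟩
  · have : b = Ω - a := by rw [← hab]; abel
    rw [this]
    exact sub_mem hΩ ha.1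
  · rw [hs_symm]
    exact hb Ω' h

/-- A type synonym for the tangent space `T_ρ 𝒪 = ad_ρ 𝔰𝔲(n)`, which will carry the invariant
Riemannian metric. -/
def TangentVec {n : ℕ} (ρ : Mat n) : Type := ↥(tangentSubmodule ρ)

noncomputable instance {n : ℕ} (ρ : Mat n) : AddCommGroup (TangentVec ρ) :=
  inferInstanceAs (AddCommGroup ↥(tangentSubmodule ρ))

noncomputable instance {n : ℕ} (ρ : Mat n) : Module ℝ (TangentVec ρ) :=
  inferInstanceAs (Module ℝ ↥(tangentSubmodule ρ))

instance {n : ℕ} (ρ : Mat n) : FiniteDimensional ℝ (TangentVec ρ) :=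
  inferInstanceAs (FiniteDimensional ℝ ↥(tangentSubmodule ρ))

/-- The inclusion `T_ρ 𝒪 → ℂ^{n × n}`. -/
noncomputable def inclLin {n : ℕ} (ρ : Mat n) : TangentVec ρ →ₗ[ℝ] Mat n := (tangentSubmodule ρ).subtype

/-- The tangent vector `ad_ρ Ω = [ρ, Ω]`, for `Ω ∈ 𝔰𝔲(n)`. -/
noncomputable def adTangent {n : ℕ} (ρ : Mat n) : su n →ₗ[ℝ] TangentVec ρ :=
  ((ad ρ).comp (su n).subtype).codRestrict (tangentSubmodule ρ)
    fun Ω => Submodule.mem_map_of_mem Ω.2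

lemma inclLin_adTangent {n : ℕ} (ρ : Mat n) (Ω : su n) :
    inclLin ρ (adTangent ρ Ω) = ⁅ρ, (Ω : Mat n)⁆ := rfl

/-- `ad_ρ` restricted to `𝔭_ρ`. -/
noncomputable def adP {n : ℕ} (ρ : Mat n) : pSpace ρ →ₗ[ℝ] TangentVec ρ :=
  (adTangent ρ).comp (Submodule.inclusion fun _ h => h.1)

lemma adP_bijective {n : ℕ} (ρ : Mat n) : Function.Bijective (adP ρ) := by
  constructor
  · rw [← LinearMap.ker_eq_bot, LinearMap.ker_eq_bot']
    rintro ⟨Ω, hΩ, hΩ'⟩ h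
    have h0 : ad ρ Ω = 0 := congrArg (inclLin ρ) h
    exact Subtype.ext (eq_zero_of_hs_self (hΩ' Ω ⟨hΩ, h0⟩))
  · rintro ⟨ξ, Ω, hΩ, rfl⟩
    obtain ⟨a, ha, b, hb, rfl⟩ := exists_decomp ρ hΩ
    refine ⟨⟨b, hb⟩, Subtype.ext ?_⟩
    have h0 : ad ρ a = 0 := ha.2
    change ad ρ b = ad ρ (a + b)
    rw [map_add, h0, zero_add]

/-- For a tangent vector `ξ = ad_ρ Ω`, `Ω ∈ 𝔰𝔲(n)`, the component `Ω^{𝔭_ρ}`. -/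
noncomputable def pLift {n : ℕ} (ρ : Mat n) : TangentVec ρ ≃ₗ[ℝ] pSpace ρ :=
  (LinearEquiv.ofBijective (adP ρ) (adP_bijective ρ)).symm

/-- The metric `⟨ad_ρ Ω₁, ad_ρ Ω₂⟩_ρ = tr((Ω₁^{𝔭_ρ})† Ω₂^{𝔭_ρ})`. -/
noncomputable instance metricCore {n : ℕ} (ρ : Mat n) :
    InnerProductSpace.Core ℝ (TangentVec ρ) where
  inner ξ η := hs n (pLift ρ ξ) (pLift ρ η)
  conj_inner_symm ξ η := hs_symm _ _
  re_inner_nonneg ξ := hs_self_nonneg _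
  add_left ξ η ζ := by simp
  smul_left ξ η r := by simp
  definite ξ h := by
    have h1 : ((pLift ρ ξ : pSpace ρ) : Mat n) = 0 := eq_zero_of_hs_self h
    exact (pLift ρ).map_eq_zero_iff.1 (Subtype.ext h1)

noncomputable instance {n : ℕ} (ρ : Mat n) : NormedAddCommGroup (TangentVec ρ) :=
  (metricCore ρ).toNormedAddCommGroup

noncomputable instance {n : ℕ} (ρ : Mat n) : InnerProductSpace ℝ (TangentVec ρ) :=
  InnerProductSpace.ofCore (metricCore ρ).toCore

instance {n : ℕ} (ρ : Mat n) : CompleteSpace (TangentVec ρ) :=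
  FiniteDimensional.complete ℝ _

/-- The explicit form of the metric: `aᵢ` and `bᵢ` are the components of `Ωᵢ` in `𝔥_ρ`
and in `𝔭_ρ`. -/
lemma inner_adTangent {n : ℕ} (ρ : Mat n) (Ω₁ Ω₂ : su n) {a₁ b₁ a₂ b₂ : Mat n}
    (ha₁ : a₁ ∈ stab ρ) (hb₁ : b₁ ∈ pSpace ρ) (h₁ : a₁ + b₁ = Ω₁)
    (ha₂ : a₂ ∈ stab ρ) (hb₂ : b₂ ∈ pSpace ρ) (h₂ : a₂ + b₂ = Ω₂) :
    inner ℝ (adTangent ρ Ω₁) (adTangent ρ Ω₂) = (b₁ᴴ * b₂).trace.re := by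
  have key : ∀ (Ω : su n) {a b : Mat n} (_ : a ∈ stab ρ) (hb : b ∈ pSpace ρ) (_ : a + b = Ω),
      pLift ρ (adTangent ρ Ω) = ⟨b, hb⟩ := by
    intro Ω a b ha hb h
    rw [pLift, LinearEquiv.symm_apply_eq]
    apply Subtype.ext
    have h0 : ad ρ a = 0 := ha.2
    change ad ρ Ω = ad ρ b
    rw [← h, map_add, h0, zero_add]
  change hs n (pLift ρ (adTangent ρ Ω₁)) (pLift ρ (adTangent ρ Ω₂)) = _
  rw [key Ω₁ ha₁ hb₁ h₁, key Ω₂ ha₂ hb₂ h₂, hs_apply]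

/-- The inclusion `T_ρ 𝒪 → ℂ^{n × n}` as a continuous linear map. -/
noncomputable def incl {n : ℕ} (ρ : Mat n) : TangentVec ρ →L[ℝ] Mat n :=
  LinearMap.toContinuousLinearMap (inclLin ρ)

/-! ### Controlled dynamics -/

/-- The space of controls `L²([0,T], ℝ)`. -/
noncomputable abbrev Control (T : ℝ) := Lp ℝ 2 ((volume : Measure ℝ).restrict (Icc 0 T))

/-- `x` is the (absolutely continuous, Carathéodory) solution on `[0,T]` of `x' = F(t, x)` with
`x(t₀) = x₀`: the integral equation `x(t) = x₀ + ∫_{t₀}^t F(s, x(s)) ds`, read entrywise, the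
integrand being integrable on `[0,T]`. -/
def IsSolution {n : ℕ} (T : ℝ) (F : ℝ → Mat n → Mat n) (t₀ : ℝ) (x₀ : Mat n)
    (x : ℝ → Mat n) : Prop :=
  ∀ i j, IntegrableOn (fun s => F s (x s) i j) (Icc 0 T) ∧
    ∀ t ∈ Icc 0 T, x t i j = x₀ i j + ∫ s in t₀..t, F s (x s) i j

section Dynamics

variable {n : ℕ} (H₀ H₁ : su n) {T : ℝ}

/-- `H₀ + u(t) H₁`. -/
noncomputable def hamiltonian (u : Control T) (t : ℝ) : Mat n :=
  (H₀ : Mat n) + u t • (H₁ : Mat n)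

/-- `U' = (H₀ + u H₁) U` on `[0,T]`, `U(0) = Id`. -/
def IsPropagator (u : Control T) (U : ℝ → Mat n) : Prop :=
  IsSolution T (fun t X => hamiltonian H₀ H₁ u t * X) 0 1 U

/-- `ρ' = [H₀ + u H₁, ρ]` on `[0,T]`, `ρ(0) = ρ₀`. -/
def IsTrajectory (ρ₀ : Mat n) (u : Control T) (ρ : ℝ → Mat n) : Prop :=
  IsSolution T (fun t X => ⁅hamiltonian H₀ H₁ u t, X⁆) 0 ρ₀ ρ

/-- The propagator `U(·)` of the control `u`. -/
noncomputable def propagator (u : Control T) : ℝ → Mat n :=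
  Classical.epsilon (IsPropagator H₀ H₁ u)

/-- The trajectory `ρ(·)` of the control `u`. -/
noncomputable def trajectory (ρ₀ : Mat n) (u : Control T) : ℝ → Mat n :=
  Classical.epsilon (IsTrajectory H₀ H₁ ρ₀ u)

/-- The transition matrix `U(t) U(s)†`: as a function of `t`, it solves the propagator equation
with value `Id` at time `s`. -/
noncomputable def transition (u : Control T) (t s : ℝ) : Mat n :=
  propagator H₀ H₁ u t * (propagator H₀ H₁ u s)ᴴ

/-- The end-point map `u ↦ ρ(T)`. -/
noncomputable def endpoint (ρ₀ : Mat n) (u : Control T) : Mat n :=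
  trajectory H₀ H₁ ρ₀ u T

/-- `D` is the differential at `u` of the end-point map, as a map into `T_{ρ(T)} 𝒪`. -/
def IsDEnd (ρ₀ : Mat n) (u : Control T)
    (D : Control T →L[ℝ] TangentVec (endpoint H₀ H₁ ρ₀ u)) : Prop :=
  HasFDerivAt (endpoint H₀ H₁ ρ₀ : Control T → Mat n) ((incl (endpoint H₀ H₁ ρ₀ u)).comp D) u

/-- The differential at `u` of the end-point map, as a map into `T_{ρ(T)} 𝒪`. -/
noncomputable def dEnd (ρ₀ : Mat n) (u : Control T) :
    Control T →L[ℝ] TangentVec (endpoint H₀ H₁ ρ₀ u) :=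
  Classical.epsilon (IsDEnd H₀ H₁ ρ₀ u)

/-- `q` is an adjoint vector along the trajectory of `u`: `q(t) ∈ T_{ρ(t)} 𝒪`,
`q' = [H₀ + u H₁, q]` on `[0,T]` and `q(T) = z`. -/
def IsAdjointVector (ρ₀ : Mat n) (u : Control T) (z : TangentVec (endpoint H₀ H₁ ρ₀ u))
    (q : ∀ t, TangentVec (trajectory H₀ H₁ ρ₀ u t)) : Prop :=
  IsSolution T (fun t X => ⁅hamiltonian H₀ H₁ u t, X⁆) T (incl _ z) (fun t => incl _ (q t))

/-- The adjoint vector with terminal value `z`. -/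
noncomputable def adjointVector (ρ₀ : Mat n) (u : Control T)
    (z : TangentVec (endpoint H₀ H₁ ρ₀ u)) : ∀ t, TangentVec (trajectory H₀ H₁ ρ₀ u t) :=
  Classical.epsilon (IsAdjointVector H₀ H₁ ρ₀ u z)

/-- The tangent vector `[H₁, ρ] = ad_ρ(-H₁)` at `ρ`. -/
noncomputable def controlField (ρ : Mat n) : TangentVec ρ :=
  ⟨⁅(H₁ : Mat n), ρ⁆, -(H₁ : Mat n), neg_mem H₁.2, by
    rw [ad_apply, Ring.lie_def, Ring.lie_def]; noncomm_ring⟩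

/-- The switching function `Φ(t) = ⟨q(t), [H₁, ρ(t)]⟩_{ρ(t)}`. -/
noncomputable def switching (ρ₀ : Mat n) (u : Control T)
    (z : TangentVec (endpoint H₀ H₁ ρ₀ u)) (t : ℝ) : ℝ :=
  inner ℝ (adjointVector H₀ H₁ ρ₀ u z t) (controlField H₁ (trajectory H₀ H₁ ρ₀ u t))

/-! ### Cost functions -/

/-- `J(ρ) = Re tr(ρ θ)`. -/
noncomputable def costOrbit (θ ρ : Mat n) : ℝ := (ρ * θ).trace.re

/-- The Riemannian gradient of `J` on the orbit at `ρ`: the vector of `T_ρ 𝒪` that represents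
the differential `dJ(ρ)`, restricted to `T_ρ 𝒪`, with respect to the metric. -/
noncomputable def gradOrbit (θ ρ : Mat n) : TangentVec ρ :=
  (InnerProductSpace.toDual ℝ (TangentVec ρ)).symm
    ((fderiv ℝ (costOrbit θ) ρ).comp (incl ρ))

/-- The cost function `𝒥(u) = Re tr(End(u) θ)`. -/
noncomputable def cost (ρ₀ θ : Mat n) (u : Control T) : ℝ :=
  costOrbit θ (endpoint H₀ H₁ ρ₀ u)

/-- `u` is a critical point of `𝒥`: `𝒥` is differentiable at `u` and `∇𝒥(u) = 0`. -/
def IsCriticalControl (ρ₀ θ : Mat n) (u : Control T) : Prop :=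
  HasGradientAt (cost H₀ H₁ ρ₀ θ) 0 u

end Dynamics

end QuantumControl

/-!
Put `V(t) = U(t) U(T)†`. In the interaction picture `σ(t) = V(t)† ρ(t) V(t)` of `u`, the trajectory
of `u + v` satisfies `σ' = v(t) [V(t)† H₁ V(t), σ]`: the drift is gone, `σ(0) = End(u)` and
`σ(T) = End(u + v)`. Freezing `σ` on the right-hand side at its initial value costs an error that is
quadratic in the `L¹` norm of `v`, so `dEnd(u) v = ∫ v(t) X(t) dt` with
`X(t) = [V(t)† H₁ V(t), ρ(T)]`. Conjugation by `V(t)` is an isometry from the tangent space at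
`ρ(T)` to the one at `ρ(t)`; it maps `z` to `q(t)` and `X(t)` to `[H₁, ρ(t)]`. Hence
`Φ_z(t) = ⟨z, X(t)⟩`, and `Φ_z` represents `dEnd*(u) z` in `L²`. For `z = ∇J` this continuous
function equals `tr([ρ(T), θ] V(t)† H₁ V(t))`, and `∇𝒥(u) = dEnd*(u) ∇J`.
-/

namespace QuantumControl

section Primitive

variable {E E' : Type*} [NormedAddCommGroup E] [NormedSpace ℝ E] [NormedAddCommGroup E']
  [NormedSpace ℝ E'] {F f : ℝ → E} {a b : ℝ}

/-- `F` is absolutely continuous on `[[a, b]]` with derivative `f`, written as an integral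
equation. No base point is singled out: an initial value is a separate equation `F t₀ = x₀`. -/
def IsPrimitiveOn (F f : ℝ → E) (a b : ℝ) : Prop :=
  IntervalIntegrable f volume a b ∧ ∀ t ∈ uIcc a b, F t = F a + ∫ s in a..t, f s

lemma absolutelyContinuousOnInterval_of_dist_le {X Y : Type*} [PseudoMetricSpace X]
    [PseudoMetricSpace Y] {F : ℝ → X} {φ : ℝ → Y} (hφ : AbsolutelyContinuousOnInterval φ a b)
    (hF : ∀ s ∈ uIcc a b, ∀ t ∈ uIcc a b, dist (F s) (F t) ≤ dist (φ s) (φ t)) :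
    AbsolutelyContinuousOnInterval F a b := by
  refine squeeze_zero' (.of_forall fun _ => Finset.sum_nonneg fun _ _ => dist_nonneg) ?_ hφ
  filter_upwards [Filter.mem_inf_of_right (Filter.mem_principal_self _)] with I hI
  exact Finset.sum_le_sum fun i hi => hF _ (hI.1 i hi).1 _ (hI.1 i hi).2

lemma absolutelyContinuousOnInterval_mul {R : Type*} [SeminormedRing R] {X Y : ℝ → R}
    (hX : AbsolutelyContinuousOnInterval X a b) (hY : AbsolutelyContinuousOnInterval Y a b) :
    AbsolutelyContinuousOnInterval (fun t => X t * Y t) a b := by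
  obtain ⟨K, hK⟩ := hX.exists_bound
  obtain ⟨L, hL⟩ := hY.exists_bound
  have hlim := (Filter.Tendsto.mul_const L hX).add (Filter.Tendsto.const_mul K hY)
  rw [zero_mul, mul_zero, add_zero] at hlim
  refine squeeze_zero' (.of_forall fun _ => Finset.sum_nonneg fun _ _ => dist_nonneg) ?_ hlim
  filter_upwards [Filter.mem_inf_of_right (Filter.mem_principal_self _)] with I hI
  rw [Finset.sum_mul, Finset.mul_sum, ← Finset.sum_add_distrib]
  refine Finset.sum_le_sum fun i hi => ?_
  obtain ⟨hs, ht⟩ := hI.1 i hi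
  simp only [dist_eq_norm]
  calc ‖X (I.2 i).1 * Y (I.2 i).1 - X (I.2 i).2 * Y (I.2 i).2‖
      = ‖(X (I.2 i).1 - X (I.2 i).2) * Y (I.2 i).1
          + X (I.2 i).2 * (Y (I.2 i).1 - Y (I.2 i).2)‖ := by congr 1; noncomm_ring
    _ ≤ ‖X (I.2 i).1 - X (I.2 i).2‖ * L + K * ‖Y (I.2 i).1 - Y (I.2 i).2‖ :=
      norm_add_le_of_le (norm_mul_le_of_le le_rfl (hL _ hs)) (norm_mul_le_of_le (hK _ ht) le_rfl)

namespace IsPrimitiveOn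

lemma integral (hf : IntervalIntegrable f volume a b) :
    IsPrimitiveOn (fun t => ∫ s in a..t, f s) f a b :=
  ⟨hf, fun t _ => by simp⟩

lemma const (c : E) : IsPrimitiveOn (fun _ => c) 0 a b := ⟨intervalIntegrable_const, by simp⟩

lemma congr_ae {f' : ℝ → E} (h : IsPrimitiveOn F f a b)
    (hf : f =ᵐ[volume.restrict (uIoc a b)] f') : IsPrimitiveOn F f' a b := by
  refine ⟨h.1.congr_ae hf, fun t ht => ?_⟩
  have hsub : uIoc a t ⊆ uIoc a b :=
    uIoc_subset_uIoc_of_uIcc_subset_uIcc (uIcc_subset_uIcc left_mem_uIcc ht)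
  rw [h.2 t ht, intervalIntegral.integral_congr_ae_restrict
    (ae_restrict_of_ae_restrict_of_subset hsub hf)]

lemma congr {F' f' : ℝ → E} (h : IsPrimitiveOn F f a b) (hF : EqOn F F' (uIcc a b))
    (hf : EqOn f f' (uIcc a b)) : IsPrimitiveOn F' f' a b := by
  refine IsPrimitiveOn.congr_ae ⟨h.1, fun t ht => ?_⟩
    ((ae_restrict_mem measurableSet_uIoc).mono fun t ht => hf (uIoc_subset_uIcc ht))
  rw [← hF ht, ← hF left_mem_uIcc, h.2 t ht]

lemma of_eq_add_integral {c : E} {t₀ : ℝ} (hf : IntervalIntegrable f volume a b)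
    (ht₀ : t₀ ∈ uIcc a b) (hF : ∀ t ∈ uIcc a b, F t = c + ∫ s in t₀..t, f s) :
    IsPrimitiveOn F f a b := by
  have hint : ∀ {s t}, s ∈ uIcc a b → t ∈ uIcc a b → IntervalIntegrable f volume s t :=
    fun hs ht => hf.mono_set (uIcc_subset_uIcc hs ht)
  refine ⟨hf, fun t ht => ?_⟩
  rw [hF t ht, hF a left_mem_uIcc, add_assoc,
    intervalIntegral.integral_add_adjacent_intervals (hint ht₀ left_mem_uIcc)
      (hint left_mem_uIcc ht)]

lemma sub_eq_integral (h : IsPrimitiveOn F f a b) {s t : ℝ} (hs : s ∈ uIcc a b)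
    (ht : t ∈ uIcc a b) : F t - F s = ∫ r in s..t, f r := by
  have hint : ∀ {r}, r ∈ uIcc a b → IntervalIntegrable f volume a r := fun hr =>
    h.1.mono_set (uIcc_subset_uIcc left_mem_uIcc hr)
  rw [h.2 t ht, h.2 s hs, add_sub_add_left_eq_sub,
    intervalIntegral.integral_interval_sub_left (hint ht) (hint hs)]

lemma eq_of_zero (h : IsPrimitiveOn F 0 a b) {s t : ℝ} (hs : s ∈ uIcc a b)
    (ht : t ∈ uIcc a b) : F s = F t := by
  simpa [sub_eq_zero] using h.sub_eq_integral ht hs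

lemma clm_comp [CompleteSpace E] [CompleteSpace E'] (h : IsPrimitiveOn F f a b) (L : E →L[ℝ] E') :
    IsPrimitiveOn (fun t => L (F t)) (fun t => L (f t)) a b := by
  refine ⟨⟨L.integrable_comp h.1.1, L.integrable_comp h.1.2⟩, fun t ht => ?_⟩
  simp only [h.2 t ht, map_add, L.intervalIntegral_comp_comm
    (h.1.mono_set (uIcc_subset_uIcc left_mem_uIcc ht))]

lemma dist_le (h : IsPrimitiveOn F f a b) {s t : ℝ} (hs : s ∈ uIcc a b) (ht : t ∈ uIcc a b) :
    dist (F s) (F t) ≤ dist (∫ r in a..s, ‖f r‖) (∫ r in a..t, ‖f r‖) := by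
  rw [dist_eq_norm, Real.dist_eq, h.sub_eq_integral ht hs,
    (IsPrimitiveOn.integral h.1.norm).sub_eq_integral ht hs]
  exact intervalIntegral.norm_integral_le_abs_integral_norm

lemma absolutelyContinuousOnInterval (h : IsPrimitiveOn F f a b) :
    AbsolutelyContinuousOnInterval F a b :=
  absolutelyContinuousOnInterval_of_dist_le
    (h.1.norm.absolutelyContinuousOnInterval_intervalIntegral left_mem_uIcc)
    fun _ hs _ ht => h.dist_le hs ht

lemma continuousOn (h : IsPrimitiveOn F f a b) : ContinuousOn F (uIcc a b) :=
  h.absolutelyContinuousOnInterval.continuousOn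

lemma ae_hasDerivAt [CompleteSpace E] (h : IsPrimitiveOn F f a b) :
    ∀ᵐ t, t ∈ uIcc a b → HasDerivAt F (f t) t := by
  filter_upwards [h.1.ae_hasDerivAt_integral, Measure.ae_ne volume (min a b),
    Measure.ae_ne volume (max a b)] with t ht hmin hmax hmem
  have hF : F =ᶠ[nhds t] fun t => F a + ∫ s in a..t, f s :=
    Filter.eventuallyEq_of_mem
      (Icc_mem_nhds (hmem.1.lt_of_ne hmin.symm) (hmem.2.lt_of_ne hmax)) h.2
  exact ((ht hmem a left_mem_uIcc).const_add (F a)).congr_of_eventuallyEq hF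

end IsPrimitiveOn

lemma isPrimitiveOn_of_ae_hasDerivAt [CompleteSpace E] (hF : AbsolutelyContinuousOnInterval F a b)
    (hf : IntervalIntegrable f volume a b) (hderiv : ∀ᵐ t, t ∈ uIcc a b → HasDerivAt F (f t) t) :
    IsPrimitiveOn F f a b := by
  have hG := IsPrimitiveOn.integral hf
  obtain ⟨c, hc⟩ := (hF.sub hG.absolutelyContinuousOnInterval).const_of_ae_hasDerivAt_zero <| by
    filter_upwards [hderiv, hG.ae_hasDerivAt] with t hFt hGt ht
    simpa using (hFt ht).sub (hGt ht)
  refine ⟨hf, fun t ht => ?_⟩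
  have hconst := (hc t ht).trans (hc a left_mem_uIcc).symm
  simp only [Pi.sub_apply, intervalIntegral.integral_same, sub_zero] at hconst
  exact sub_eq_iff_eq_add.1 hconst

section Algebra

variable {R : Type*} [NormedRing R] [NormedAlgebra ℝ R] [CompleteSpace R] {X Y X' Y' : ℝ → R}

protected lemma IsPrimitiveOn.mul (hX : IsPrimitiveOn X X' a b) (hY : IsPrimitiveOn Y Y' a b) :
    IsPrimitiveOn (fun t => X t * Y t) (fun t => X' t * Y t + X t * Y' t) a b := by
  refine isPrimitiveOn_of_ae_hasDerivAt
      (absolutelyContinuousOnInterval_mul hX.absolutelyContinuousOnInterval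
        hY.absolutelyContinuousOnInterval)
    ((hX.1.mul_continuousOn hY.continuousOn).add (hY.1.continuousOn_mul hX.continuousOn)) ?_
  filter_upwards [hX.ae_hasDerivAt, hY.ae_hasDerivAt] with t hXt hYt ht
  exact (hXt ht).mul (hYt ht)

end Algebra

lemma IsPrimitiveOn.pow_div_factorial_mul {φ φ' : ℝ → ℝ} (h : IsPrimitiveOn φ φ' a b) (c : ℝ)
    (m : ℕ) : IsPrimitiveOn (fun t => φ t ^ (m + 1) / (m + 1).factorial * c)
      (fun t => φ' t * (φ t ^ m / m.factorial * c)) a b := by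
  induction m with
  | zero => simpa using h.mul (.const c)
  | succ m ih =>
    have hmul := (h.mul ih).mul (.const ((m + 2 : ℝ)⁻¹))
    refine hmul.congr (fun t _ => ?_) (fun t _ => ?_) <;>
    · simp only [Nat.factorial_succ (m + 1), Nat.factorial_succ m, Pi.zero_apply]
      push_cast
      field_simp
      ring

section LinearEquation

variable {R : Type*} [NormedRing R] {A : ℝ → R}

lemma intervalIntegrable_mul_IccExtend (hab : a ≤ b) (hA : IntervalIntegrable A volume a b)
    (X : C(Icc a b, R)) : IntervalIntegrable (fun s => A s * IccExtend hab X s) volume a b :=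
  hA.mul_continuousOn X.continuous.Icc_extend'.continuousOn

variable [NormedAlgebra ℝ R]

/-- The Picard operator of the linear equation `X' = A X`, `X a = X₀`. -/
noncomputable def picard (hab : a ≤ b) (hA : IntervalIntegrable A volume a b) (X₀ : R)
    (X : C(Icc a b, R)) : C(Icc a b, R) where
  toFun t := X₀ + ∫ s in a..t, A s * IccExtend hab X s
  continuous_toFun := by
    have hX := (IsPrimitiveOn.integral (intervalIntegrable_mul_IccExtend hab hA X)).continuousOn
    rw [uIcc_of_le hab] at hX
    exact continuous_const.add hX.domRestrict

lemma norm_picard_sub_le (hab : a ≤ b) (hA : IntervalIntegrable A volume a b) (X₀ : R)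
    {X Y : C(Icc a b, R)} {φ : ℝ → ℝ} (hφ : IntervalIntegrable (fun s => ‖A s‖ * φ s) volume a b)
    (h : ∀ t : Icc a b, ‖X t - Y t‖ ≤ φ t) (t : Icc a b) :
    ‖picard hab hA X₀ X t - picard hab hA X₀ Y t‖ ≤ ∫ s in a..t, ‖A s‖ * φ s := by
  have hsub : uIcc a t ⊆ uIcc a b := uIcc_subset_uIcc left_mem_uIcc (Icc_subset_uIcc t.2)
  have hint := fun X => (intervalIntegrable_mul_IccExtend hab hA X).mono_set hsub
  have hdiff : picard hab hA X₀ X t - picard hab hA X₀ Y t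
      = ∫ s in a..t, A s * (IccExtend hab X s - IccExtend hab Y s) := by
    simp only [picard, ContinuousMap.coe_mk, add_sub_add_left_eq_sub, mul_sub,
      intervalIntegral.integral_sub (hint X) (hint Y)]
  rw [hdiff]
  refine intervalIntegral.norm_integral_le_of_norm_le t.2.1 (.of_forall fun s hs => ?_)
    (hφ.mono_set hsub)
  have hs' : s ∈ Icc a b := ⟨hs.1.le, hs.2.trans t.2.2⟩
  rw [IccExtend_of_mem hab X hs', IccExtend_of_mem hab Y hs']
  exact norm_mul_le_of_le le_rfl (h ⟨s, hs'⟩)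

lemma norm_iterate_picard_sub_le (hab : a ≤ b) (hA : IntervalIntegrable A volume a b) (X₀ : R)
    (X Y : C(Icc a b, R)) (m : ℕ) (t : Icc a b) :
    ‖(picard hab hA X₀)^[m] X t - (picard hab hA X₀)^[m] Y t‖
      ≤ (∫ s in a..t, ‖A s‖) ^ m / m.factorial * dist X Y := by
  induction m generalizing t with
  | zero => simpa [dist_eq_norm] using (X - Y).norm_coe_le_norm t
  | succ m ih =>
    have hpow := (IsPrimitiveOn.integral hA.norm).pow_div_factorial_mul (dist X Y) m
    rw [Function.iterate_succ_apply', Function.iterate_succ_apply']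
    refine (norm_picard_sub_le hab hA X₀ hpow.1 ih t).trans_eq ?_
    simpa using (hpow.2 t (Icc_subset_uIcc t.2)).symm

lemma exists_contractingWith_iterate_picard (hab : a ≤ b) (hA : IntervalIntegrable A volume a b)
    (X₀ : R) : ∃ m, ContractingWith 2⁻¹ (picard hab hA X₀)^[m] := by
  have hlim := FloorSemiring.tendsto_pow_div_factorial_atTop (∫ s in a..b, ‖A s‖)
  obtain ⟨m, hm⟩ := (hlim.eventually_le_const (show (0 : ℝ) < 2⁻¹ by norm_num)).exists
  refine ⟨m, by norm_num, LipschitzWith.of_dist_le_mul fun X Y => ?_⟩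
  refine (ContinuousMap.dist_le (by positivity)).2 fun t => ?_
  have hnonneg : 0 ≤ ∫ s in a..t, ‖A s‖ :=
    intervalIntegral.integral_nonneg t.2.1 fun _ _ => norm_nonneg _
  have hmono : ∫ s in a..t, ‖A s‖ ≤ ∫ s in a..b, ‖A s‖ :=
    intervalIntegral.integral_mono_interval le_rfl t.2.1 t.2.2 (.of_forall fun _ => norm_nonneg _)
      hA.norm
  calc dist ((picard hab hA X₀)^[m] X t) ((picard hab hA X₀)^[m] Y t)
      ≤ (∫ s in a..t, ‖A s‖) ^ m / m.factorial * dist X Y := by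
        rw [dist_eq_norm]
        exact norm_iterate_picard_sub_le hab hA X₀ X Y m t
    _ ≤ (∫ s in a..b, ‖A s‖) ^ m / m.factorial * dist X Y := by gcongr
    _ ≤ 2⁻¹ * dist X Y := by gcongr

lemma exists_isPrimitiveOn_linear [CompleteSpace R] (hab : a ≤ b)
    (hA : IntervalIntegrable A volume a b) (X₀ : R) :
    ∃ X : ℝ → R, X a = X₀ ∧ IsPrimitiveOn X (fun t => A t * X t) a b := by
  obtain ⟨m, hm⟩ := exists_contractingWith_iterate_picard hab hA X₀
  set X := hm.fixedPoint
  have hX : picard hab hA X₀ X = X := hm.isFixedPt_fixedPoint_iterate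
  have heq : ∀ t ∈ Icc a b, IccExtend hab X t = X₀ + ∫ s in a..t, A s * IccExtend hab X s := by
    intro t ht
    nth_rewrite 1 [← hX]
    rw [IccExtend_of_mem hab _ ht]
    rfl
  have ha : IccExtend hab X a = X₀ := by simpa using heq a (left_mem_Icc.2 hab)
  refine ⟨IccExtend hab X, ha, intervalIntegrable_mul_IccExtend hab hA X, fun t ht => ?_⟩
  rw [ha, heq t (uIcc_of_le hab ▸ ht)]

end LinearEquation

end Primitive

section Remainder

variable {E : Type*} [NormedAddCommGroup E] [NormedSpace ℝ E] {y : ℝ → E} {v : ℝ → ℝ}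
  {f : ℝ → E → E} {a b M : ℝ} {K : NNReal}

lemma IsPrimitiveOn.norm_sub_le {g : ℝ → E} (hv : IntervalIntegrable v volume a b)
    (hy : IsPrimitiveOn y (fun t => v t • g t) a b)
    (hM : ∀ t ∈ Icc a b, ‖g t‖ ≤ M) {t : ℝ} (ht : t ∈ Icc a b) :
    ‖y t - y a‖ ≤ M * ∫ s in a..b, ‖v s‖ := by
  have hM₀ : 0 ≤ M := (norm_nonneg _).trans (hM t ht)
  have hat : uIcc a t ⊆ uIcc a b := uIcc_subset_uIcc left_mem_uIcc (Icc_subset_uIcc ht)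
  rw [hy.sub_eq_integral left_mem_uIcc (Icc_subset_uIcc ht)]
  calc ‖∫ s in a..t, v s • g s‖ ≤ ∫ s in a..t, M * ‖v s‖ := by
        refine intervalIntegral.norm_integral_le_of_norm_le ht.1 (.of_forall fun s hs => ?_)
          ((hv.mono_set hat).norm.const_mul M)
        rw [norm_smul, mul_comm]
        gcongr
        exact hM s ⟨hs.1.le, hs.2.trans ht.2⟩
    _ = M * ∫ s in a..t, ‖v s‖ := intervalIntegral.integral_const_mul ..
    _ ≤ M * ∫ s in a..b, ‖v s‖ := by
        gcongr
        exact intervalIntegral.integral_mono_interval le_rfl ht.1 ht.2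
          (.of_forall fun _ => norm_nonneg _) hv.norm

lemma IsPrimitiveOn.norm_sub_sub_integral_le (hab : a ≤ b) (hv : IntervalIntegrable v volume a b)
    (hy : IsPrimitiveOn y (fun t => v t • f t (y t)) a b)
    (hf : ∀ t ∈ Icc a b, LipschitzWith K (f t)) (hM : ∀ t ∈ Icc a b, ‖f t (y t)‖ ≤ M)
    (hint : IntervalIntegrable (fun t => v t • f t (y a)) volume a b) :
    ‖y b - y a - ∫ t in a..b, v t • f t (y a)‖ ≤ K * M * (∫ t in a..b, ‖v t‖) ^ 2 := by
  rw [hy.sub_eq_integral left_mem_uIcc right_mem_uIcc,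
    ← intervalIntegral.integral_sub hy.1 hint]
  calc ‖∫ t in a..b, v t • f t (y t) - v t • f t (y a)‖
      ≤ ∫ t in a..b, K * (M * ∫ s in a..b, ‖v s‖) * ‖v t‖ := by
        refine intervalIntegral.norm_integral_le_of_norm_le hab (.of_forall fun t ht => ?_)
          (hv.norm.const_mul _)
        have ht' : t ∈ Icc a b := Ioc_subset_Icc_self ht
        rw [← smul_sub, norm_smul, mul_comm]
        gcongr
        exact (hf t ht').norm_sub_le_of_le (hy.norm_sub_le hv hM ht')
    _ = K * M * (∫ t in a..b, ‖v t‖) ^ 2 := by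
        rw [intervalIntegral.integral_const_mul]
        ring

end Remainder

section StarRing

variable {R : Type*} [Ring R] [StarRing R] {V : R}

lemma conj_mul_conj (hV : star V * V = 1) (A B : R) :
    V * A * star V * (V * B * star V) = V * (A * B) * star V := by
  calc V * A * star V * (V * B * star V) = V * A * (star V * V) * B * star V := by noncomm_ring
    _ = V * (A * B) * star V := by rw [hV]; noncomm_ring

lemma conj_lie_conj (hV : star V * V = 1) (A B : R) :
    ⁅V * A * star V, V * B * star V⁆ = V * ⁅A, B⁆ * star V := by
  simp only [Ring.lie_def, conj_mul_conj hV, mul_sub, sub_mul]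

lemma star_conj_conj (hV : star V * V = 1) (A : R) : star V * (V * A * star V) * V = A := by
  calc star V * (V * A * star V) * V = (star V * V) * A * (star V * V) := by noncomm_ring
    _ = A := by rw [hV]; noncomm_ring

end StarRing

section UnitaryFlow

variable {R : Type*} [NormedRing R] [NormedAlgebra ℝ R] [CompleteSpace R] [StarRing R]
  [ContinuousStar R] [StarModule ℝ R] {A X Y Y' : ℝ → R} {a b t₀ t : ℝ}

namespace IsPrimitiveOn

protected lemma star (hY : IsPrimitiveOn Y Y' a b) :
    IsPrimitiveOn (fun t => star (Y t)) (fun t => star (Y' t)) a b :=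
  hY.clm_comp (starL' ℝ : R ≃L[ℝ] R).toContinuousLinearMap

lemma star_mul (hA : ∀ t, A t ∈ skewAdjoint R) (hX : IsPrimitiveOn X (fun t => A t * X t) a b)
    (hY : IsPrimitiveOn Y Y' a b) :
    IsPrimitiveOn (fun t => star (X t) * Y t) (fun t => star (X t) * (Y' t - A t * Y t)) a b := by
  refine (hX.star.mul hY).congr (fun _ _ => rfl) fun t _ => ?_
  simp only [StarMul.star_mul, skewAdjoint.mem_iff.1 (hA t)]
  noncomm_ring

lemma star_conj (hA : ∀ t, A t ∈ skewAdjoint R) (hX : IsPrimitiveOn X (fun t => A t * X t) a b)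
    (hY : IsPrimitiveOn Y Y' a b) :
    IsPrimitiveOn (fun t => star (X t) * Y t * X t)
      (fun t => star (X t) * (Y' t - ⁅A t, Y t⁆) * X t) a b := by
  refine ((star_mul hA hX hY).mul hX).congr (fun _ _ => rfl) fun t _ => ?_
  simp only [Ring.lie_def]
  noncomm_ring

lemma conj_const (hA : ∀ t, A t ∈ skewAdjoint R) (hX : IsPrimitiveOn X (fun t => A t * X t) a b)
    (Z : R) :
    IsPrimitiveOn (fun t => X t * Z * star (X t)) (fun t => ⁅A t, X t * Z * star (X t)⁆) a b := by
  refine ((hX.mul (.const Z)).mul hX.star).congr (fun _ _ => rfl) fun t _ => ?_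
  simp only [StarMul.star_mul, skewAdjoint.mem_iff.1 (hA t), Ring.lie_def, Pi.zero_apply]
  noncomm_ring

lemma star_mul_eq (hA : ∀ t, A t ∈ skewAdjoint R)
    (hX : IsPrimitiveOn X (fun t => A t * X t) a b) (hY : IsPrimitiveOn Y (fun t => A t * Y t) a b)
    (ht₀ : t₀ ∈ uIcc a b) (ht : t ∈ uIcc a b) :
    star (X t) * Y t = star (X t₀) * Y t₀ :=
  ((star_mul hA hX hY).congr (fun _ _ => rfl) fun t _ => by simp).eq_of_zero ht ht₀

lemma star_conj_eq (hA : ∀ t, A t ∈ skewAdjoint R)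
    (hX : IsPrimitiveOn X (fun t => A t * X t) a b) (hY : IsPrimitiveOn Y (fun t => ⁅A t, Y t⁆) a b)
    (ht₀ : t₀ ∈ uIcc a b) (ht : t ∈ uIcc a b) :
    star (X t) * Y t * X t = star (X t₀) * Y t₀ * X t₀ :=
  ((star_conj hA hX hY).congr (fun _ _ => rfl) fun t _ => by simp).eq_of_zero ht ht₀

lemma interaction_picture (hA : ∀ t, A t ∈ skewAdjoint R)
    (hX : IsPrimitiveOn X (fun t => A t * X t) a b) (hU : ∀ t ∈ uIcc a b, X t ∈ unitary R)
    {v : ℝ → ℝ} {B : R} (hY : IsPrimitiveOn Y (fun t => ⁅A t + v t • B, Y t⁆) a b) :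
    IsPrimitiveOn (fun t => star (X t) * Y t * X t)
      (fun t => v t • ⁅star (X t) * B * X t, star (X t) * Y t * X t⁆) a b := by
  refine (star_conj hA hX hY).congr (fun _ _ => rfl) fun t ht => ?_
  have hlie : ⁅A t + v t • B, Y t⁆ - ⁅A t, Y t⁆ = v t • ⁅B, Y t⁆ := by
    simp only [Ring.lie_def, add_mul, mul_add, smul_mul_assoc, mul_smul_comm, smul_sub]
    abel
  have hconj := conj_lie_conj (V := star (X t)) (by simpa using (hU t ht).2) B (Y t)
  simp only [star_star] at hconj
  simp only [hlie, hconj, mul_smul_comm, smul_mul_assoc]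

variable [IsDedekindFiniteMonoid R]

lemma mem_unitary (hA : ∀ t, A t ∈ skewAdjoint R) (hX : IsPrimitiveOn X (fun t => A t * X t) a b)
    (ht₀ : t₀ ∈ uIcc a b) (hX₀ : X t₀ ∈ unitary R) (ht : t ∈ uIcc a b) : X t ∈ unitary R := by
  have h : star (X t) * X t = 1 := (star_mul_eq hA hX hX ht₀ ht).trans hX₀.1
  exact ⟨h, mul_eq_one_symm h⟩

lemma eq_mul_of_linear (hA : ∀ t, A t ∈ skewAdjoint R)
    (hX : IsPrimitiveOn X (fun t => A t * X t) a b) (ht₀ : t₀ ∈ uIcc a b) (hX₀ : X t₀ = 1)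
    (hY : IsPrimitiveOn Y (fun t => A t * Y t) a b) (ht : t ∈ uIcc a b) : Y t = X t * Y t₀ := by
  have hU := mem_unitary hA hX ht₀ (hX₀ ▸ one_mem _) ht
  calc Y t = X t * (star (X t) * Y t) := by rw [← mul_assoc, hU.2, one_mul]
    _ = X t * Y t₀ := by rw [star_mul_eq hA hX hY ht₀ ht, hX₀, star_one, one_mul]

lemma eq_conj_of_lie (hA : ∀ t, A t ∈ skewAdjoint R)
    (hX : IsPrimitiveOn X (fun t => A t * X t) a b) (ht₀ : t₀ ∈ uIcc a b) (hX₀ : X t₀ = 1)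
    (hY : IsPrimitiveOn Y (fun t => ⁅A t, Y t⁆) a b) (ht : t ∈ uIcc a b) :
    Y t = X t * Y t₀ * star (X t) := by
  have hU := mem_unitary hA hX ht₀ (hX₀ ▸ one_mem _) ht
  calc Y t = X t * (star (X t) * Y t * X t) * star (X t) := by
        simpa only [star_star] using (star_conj_conj (V := star (X t)) (by simpa using hU.2) _).symm
    _ = X t * Y t₀ * star (X t) := by
        rw [star_conj_eq hA hX hY ht₀ ht, hX₀, star_one, one_mul, mul_one]

end IsPrimitiveOn

end UnitaryFlow

lemma integral_norm_le_mul_norm {α E : Type*} [MeasurableSpace α] [NormedAddCommGroup E]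
    {μ : Measure α} [IsFiniteMeasure μ] {p : ℝ≥0∞} (hp : 1 ≤ p) (f : Lp E p μ) :
    ∫ x, ‖f x‖ ∂μ ≤ ‖f‖ * μ.real univ ^ (1 - 1 / p.toReal) := by
  have hf := Lp.aestronglyMeasurable f
  have hle := eLpNorm_le_eLpNorm_mul_rpow_measure_univ hp hf
  rw [ENNReal.toReal_one, div_one] at hle
  have hexp : 0 ≤ 1 - 1 / p.toReal := by
    rcases eq_or_ne p ∞ with rfl | hp'
    · simp
    · have : 1 ≤ p.toReal := by simpa using ENNReal.toReal_mono hp' hp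
      exact sub_nonneg.2 (div_le_one_of_le₀ this (by positivity))
  rw [← lpNorm_one_eq_integral_norm hf, ← toReal_eLpNorm hf, Lp.norm_def, Measure.real,
    ENNReal.toReal_rpow, ← ENNReal.toReal_mul]
  exact ENNReal.toReal_mono
    (ENNReal.mul_ne_top (Lp.eLpNorm_ne_top f) (ENNReal.rpow_ne_top_of_nonneg hexp (by simp))) hle

section Dynamics

open scoped Matrix.Norms.L2Operator

/-- The operator norm as a norm of real algebras; Mathlib provides the complex structure only. -/
noncomputable abbrev realNormedAlgebra (n : ℕ) : NormedAlgebra ℝ (Mat n) where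
  __ := (inferInstance : Algebra ℝ (Mat n))
  norm_smul_le r A := by
    simpa only [Complex.norm_real, Complex.coe_smul] using norm_smul_le (r : ℂ) A

attribute [local instance] realNormedAlgebra

variable {n : ℕ} {a b : ℝ}

lemma intervalIntegrable_mat_iff {f : ℝ → Mat n} :
    IntervalIntegrable f volume a b ↔ ∀ i j, IntervalIntegrable (fun t => f t i j) volume a b := by
  refine ⟨fun h i j => ?_, fun h => ?_⟩
  · let e : Mat n →L[ℝ] ℂ := (Matrix.entryLinearMap ℝ ℂ i j).toContinuousLinearMap
    exact ⟨e.integrable_comp h.1, e.integrable_comp h.2⟩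
  · have hsum : f = ∑ i, ∑ j, fun t => Matrix.single i j (f t i j) := by
      ext1 t
      simpa only [Finset.sum_apply] using (f t).matrix_eq_sum_single
    rw [hsum]
    refine .sum _ fun i _ => .sum _ fun j _ => ?_
    let e : ℂ →L[ℝ] Mat n := (Matrix.singleLinearMap ℝ i j).toContinuousLinearMap
    exact ⟨e.integrable_comp (h i j).1, e.integrable_comp (h i j).2⟩

lemma intervalIntegral_mat_apply {f : ℝ → Mat n} (hf : IntervalIntegrable f volume a b)
    (i j : Fin n) : (∫ t in a..b, f t) i j = ∫ t in a..b, f t i j :=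
  ((Matrix.entryLinearMap ℝ ℂ i j).toContinuousLinearMap.intervalIntegral_comp_comm hf).symm

variable {T : ℝ}

lemma isSolution_iff {F : ℝ → Mat n → Mat n} {t₀ : ℝ} {x₀ : Mat n} {x : ℝ → Mat n}
    (ht₀ : t₀ ∈ Icc 0 T) :
    IsSolution T F t₀ x₀ x ↔ x t₀ = x₀ ∧ IsPrimitiveOn x (fun t => F t (x t)) 0 T := by
  have hT : 0 ≤ T := ht₀.1.trans ht₀.2
  have hint : IntervalIntegrable (fun t => F t (x t)) volume 0 T ↔
      ∀ i j, IntegrableOn (fun t => F t (x t) i j) (Icc 0 T) :=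
    intervalIntegrable_mat_iff.trans
      (forall₂_congr fun _ _ => intervalIntegrable_iff_integrableOn_Icc_of_le hT)
  have hentry : ∀ {t}, t ∈ Icc 0 T → IntervalIntegrable (fun t => F t (x t)) volume 0 T →
      ∀ i j, (∫ s in t₀..t, F s (x s)) i j = ∫ s in t₀..t, F s (x s) i j := fun ht h =>
    intervalIntegral_mat_apply (h.mono_set (uIcc_of_le hT ▸ uIcc_subset_Icc ht₀ ht))
  constructor
  · intro h
    have hF := hint.2 fun i j => (h i j).1
    refine ⟨?_, .of_eq_add_integral (c := x₀) hF (uIcc_of_le hT ▸ ht₀) fun t ht => ?_⟩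
    · ext i j
      simpa using (h i j).2 t₀ ht₀
    · rw [uIcc_of_le hT] at ht
      ext i j
      rw [(h i j).2 t ht, Matrix.add_apply, hentry ht hF]
  · rintro ⟨rfl, hx⟩ i j
    refine ⟨hint.1 hx.1 i j, fun t ht => ?_⟩
    rw [← hentry ht hx.1, ← hx.sub_eq_integral (uIcc_of_le hT ▸ ht₀) (uIcc_of_le hT ▸ ht)]
    simp

variable {H₀ H₁ : su n}

lemma hamiltonian_mem_skewAdjoint (u : Control T) (t : ℝ) :
    hamiltonian H₀ H₁ u t ∈ skewAdjoint (Mat n) := by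
  have hH : ∀ H : su n, (H : Mat n) ∈ skewAdjoint (Mat n) := fun H => H.2.1
  exact add_mem (hH H₀) (skewAdjoint.smul_mem _ (hH H₁))

lemma hamiltonian_add_ae (u v : Control T) : ∀ᵐ t ∂volume.restrict (Icc 0 T),
    hamiltonian H₀ H₁ (u + v) t = hamiltonian H₀ H₁ u t + v t • (H₁ : Mat n) := by
  filter_upwards [Lp.coeFn_add u v] with t ht
  rw [hamiltonian, ht, Pi.add_apply, add_smul, ← add_assoc, hamiltonian]

lemma intervalIntegrable_control (hT : 0 ≤ T) (u : Control T) :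
    IntervalIntegrable u volume 0 T :=
  (intervalIntegrable_iff_integrableOn_Icc_of_le hT).2 ((Lp.memLp u).integrable one_le_two)

lemma intervalIntegrable_hamiltonian (hT : 0 ≤ T) (u : Control T) :
    IntervalIntegrable (hamiltonian H₀ H₁ u) volume 0 T :=
  intervalIntegrable_const.add
    ((intervalIntegrable_control hT u).smul_continuousOn continuousOn_const)

lemma isPropagator_iff (hT : 0 ≤ T) {u : Control T} {U : ℝ → Mat n} :
    IsPropagator H₀ H₁ u U ↔
      U 0 = 1 ∧ IsPrimitiveOn U (fun t => hamiltonian H₀ H₁ u t * U t) 0 T :=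
  isSolution_iff ⟨le_rfl, hT⟩

lemma isTrajectory_iff (hT : 0 ≤ T) {ρ₀ : Mat n} {u : Control T} {ρ : ℝ → Mat n} :
    IsTrajectory H₀ H₁ ρ₀ u ρ ↔
      ρ 0 = ρ₀ ∧ IsPrimitiveOn ρ (fun t => ⁅hamiltonian H₀ H₁ u t, ρ t⁆) 0 T :=
  isSolution_iff ⟨le_rfl, hT⟩

lemma isPropagator_propagator (hT : 0 ≤ T) (u : Control T) :
    IsPropagator H₀ H₁ u (propagator H₀ H₁ u) := by
  obtain ⟨U, hU⟩ := exists_isPrimitiveOn_linear hT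
    (intervalIntegrable_hamiltonian (H₀ := H₀) (H₁ := H₁) hT u) 1
  exact Classical.epsilon_spec ⟨U, (isPropagator_iff hT).2 hU⟩

lemma isPrimitiveOn_propagator (hT : 0 ≤ T) (u : Control T) :
    IsPrimitiveOn (propagator H₀ H₁ u)
      (fun t => hamiltonian H₀ H₁ u t * propagator H₀ H₁ u t) 0 T :=
  ((isPropagator_iff hT).1 (isPropagator_propagator hT u)).2

lemma propagator_zero (hT : 0 ≤ T) (u : Control T) : propagator H₀ H₁ u 0 = 1 :=
  ((isPropagator_iff hT).1 (isPropagator_propagator hT u)).1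

lemma propagator_mem_unitary {t : ℝ} (ht : t ∈ Icc 0 T) (u : Control T) :
    propagator H₀ H₁ u t ∈ unitary (Mat n) := by
  have hT := ht.1.trans ht.2
  refine (isPrimitiveOn_propagator hT u).mem_unitary (hamiltonian_mem_skewAdjoint u) left_mem_uIcc
    ?_ (Icc_subset_uIcc ht)
  rw [propagator_zero hT u]
  exact one_mem _

lemma IsPropagator.eqOn (hT : 0 ≤ T) {u : Control T} {U : ℝ → Mat n}
    (hU : IsPropagator H₀ H₁ u U) : EqOn U (propagator H₀ H₁ u) (Icc 0 T) := by
  intro t ht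
  obtain ⟨hU₀, hU⟩ := (isPropagator_iff hT).1 hU
  rw [(isPrimitiveOn_propagator hT u).eq_mul_of_linear (hamiltonian_mem_skewAdjoint u)
    left_mem_uIcc (propagator_zero hT u) hU (Icc_subset_uIcc ht), hU₀, mul_one]

lemma isTrajectory_trajectory (hT : 0 ≤ T) (ρ₀ : Mat n) (u : Control T) :
    IsTrajectory H₀ H₁ ρ₀ u (trajectory H₀ H₁ ρ₀ u) := by
  refine Classical.epsilon_spec ⟨_, (isTrajectory_iff hT).2 ⟨?_,
    (isPrimitiveOn_propagator hT u).conj_const (hamiltonian_mem_skewAdjoint u) ρ₀⟩⟩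
  rw [propagator_zero hT, star_one, one_mul, mul_one]

lemma isPrimitiveOn_trajectory (hT : 0 ≤ T) (ρ₀ : Mat n) (u : Control T) :
    IsPrimitiveOn (trajectory H₀ H₁ ρ₀ u)
      (fun t => ⁅hamiltonian H₀ H₁ u t, trajectory H₀ H₁ ρ₀ u t⁆) 0 T :=
  ((isTrajectory_iff hT).1 (isTrajectory_trajectory hT ρ₀ u)).2

lemma trajectory_zero (hT : 0 ≤ T) (ρ₀ : Mat n) (u : Control T) :
    trajectory H₀ H₁ ρ₀ u 0 = ρ₀ :=
  ((isTrajectory_iff hT).1 (isTrajectory_trajectory hT ρ₀ u)).1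

lemma IsTrajectory.eq_conj {ρ₀ : Mat n} {u : Control T} {ρ : ℝ → Mat n}
    (hρ : IsTrajectory H₀ H₁ ρ₀ u ρ) {t : ℝ} (ht : t ∈ Icc 0 T) :
    ρ t = propagator H₀ H₁ u t * ρ₀ * (propagator H₀ H₁ u t)ᴴ := by
  have hT := ht.1.trans ht.2
  obtain ⟨hρ₀, hρ'⟩ := (isTrajectory_iff hT).1 hρ
  rw [(isPrimitiveOn_propagator hT u).eq_conj_of_lie (hamiltonian_mem_skewAdjoint u)
    left_mem_uIcc (propagator_zero hT u) hρ' (Icc_subset_uIcc ht), hρ₀,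
    Matrix.star_eq_conjTranspose]

lemma trajectory_eq_conj (ρ₀ : Mat n) (u : Control T) {t : ℝ} (ht : t ∈ Icc 0 T) :
    trajectory H₀ H₁ ρ₀ u t = propagator H₀ H₁ u t * ρ₀ * (propagator H₀ H₁ u t)ᴴ :=
  (isTrajectory_trajectory (ht.1.trans ht.2) ρ₀ u).eq_conj ht

lemma IsTrajectory.eqOn {ρ₀ : Mat n} {u : Control T} {ρ : ℝ → Mat n}
    (hρ : IsTrajectory H₀ H₁ ρ₀ u ρ) : EqOn ρ (trajectory H₀ H₁ ρ₀ u) (Icc 0 T) := fun _ ht =>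
  (hρ.eq_conj ht).trans (trajectory_eq_conj ρ₀ u ht).symm

lemma isPrimitiveOn_transition (hT : 0 ≤ T) (u : Control T) :
    IsPrimitiveOn (fun t => transition H₀ H₁ u t T)
      (fun t => hamiltonian H₀ H₁ u t * transition H₀ H₁ u t T) 0 T :=
  ((isPrimitiveOn_propagator hT u).mul (.const _)).congr (fun _ _ => rfl) fun t _ => by
    simp only [transition, Pi.zero_apply, mul_zero, add_zero, mul_assoc]

lemma transition_mem_unitary {s t : ℝ} (hs : s ∈ Icc 0 T) (ht : t ∈ Icc 0 T) (u : Control T) :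
    transition H₀ H₁ u t s ∈ unitary (Mat n) :=
  mul_mem (propagator_mem_unitary ht u) (Unitary.star_mem (propagator_mem_unitary hs u))

lemma transition_self {t : ℝ} (ht : t ∈ Icc 0 T) (u : Control T) : transition H₀ H₁ u t t = 1 :=
  (propagator_mem_unitary ht u).2

lemma trajectory_eq_transition_conj (ρ₀ : Mat n) (u : Control T) {t : ℝ} (ht : t ∈ Icc 0 T) :
    trajectory H₀ H₁ ρ₀ u t
      = transition H₀ H₁ u t T * endpoint H₀ H₁ ρ₀ u * (transition H₀ H₁ u t T)ᴴ := by
  have hT := ht.1.trans ht.2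
  rw [(isPrimitiveOn_transition hT u).eq_conj_of_lie (hamiltonian_mem_skewAdjoint u)
    right_mem_uIcc (transition_self ⟨hT, le_rfl⟩ u) (isPrimitiveOn_trajectory hT ρ₀ u)
    (Icc_subset_uIcc ht), endpoint, Matrix.star_eq_conjTranspose]

end Dynamics

section TangentSpace

variable {n : ℕ}

lemma conj_mem_su {V A : Mat n} (hV : star V * V = 1) (hA : A ∈ su n) :
    V * A * star V ∈ su n := by
  refine ⟨skewAdjoint.conjugate (x := A) hA.1 V, ?_⟩
  rw [Matrix.trace_mul_comm, ← mul_assoc, hV, one_mul, hA.2]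

lemma conj_mem_stab {V ρ Ω : Mat n} (hV : star V * V = 1) (hΩ : Ω ∈ stab ρ) :
    V * Ω * star V ∈ stab (V * ρ * star V) := by
  refine ⟨conj_mem_su hV hΩ.1, ?_⟩
  have h : ⁅ρ, Ω⁆ = 0 := hΩ.2
  change ⁅V * ρ * star V, V * Ω * star V⁆ = 0
  rw [conj_lie_conj hV, h, mul_zero, zero_mul]

lemma trace_conj_mul_conj {V : Mat n} (hV : star V * V = 1) (A B : Mat n) :
    (V * A * star V * (V * B * star V)).trace = (A * B).trace := by
  rw [conj_mul_conj hV, Matrix.trace_mul_comm, ← mul_assoc, hV, one_mul]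

lemma hs_conj {V : Mat n} (hV : star V * V = 1) (A B : Mat n) :
    hs n (V * A * star V) (V * B * star V) = hs n A B := by
  have hstar : (V * A * star V)ᴴ = V * Aᴴ * star V := by
    simp only [Matrix.conjTranspose_mul, Matrix.star_eq_conjTranspose,
      Matrix.conjTranspose_conjTranspose, mul_assoc]
  rw [hs_apply, hstar, trace_conj_mul_conj hV, hs_apply]

lemma incl_injective (ρ : Mat n) : Function.Injective (incl ρ) := Subtype.val_injective

lemma exists_adTangent_eq {ρ : Mat n} (ξ : TangentVec ρ) : ∃ Ω : su n, adTangent ρ Ω = ξ := by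
  obtain ⟨ξ, Ω, hΩ, rfl⟩ := ξ
  exact ⟨⟨Ω, hΩ⟩, rfl⟩

lemma incl_adTangent_conj {V : Mat n} (hV : star V * V = 1) (ρ : Mat n) (Ω : su n) :
    incl (V * ρ * star V) (adTangent _ ⟨V * Ω * star V, conj_mem_su hV Ω.2⟩)
      = V * incl ρ (adTangent ρ Ω) * star V :=
  conj_lie_conj hV ρ Ω

lemma exists_incl_eq_conj {V ρ σ : Mat n} (hV : star V * V = 1) (hσ : σ = V * ρ * star V)
    (ξ : TangentVec ρ) : ∃ η : TangentVec σ, incl σ η = V * incl ρ ξ * star V := by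
  subst hσ
  obtain ⟨Ω, rfl⟩ := exists_adTangent_eq ξ
  exact ⟨_, incl_adTangent_conj hV ρ Ω⟩

lemma inner_adTangent_conj {V : Mat n} (hV : star V * V = 1) (ρ : Mat n) (Ω₁ Ω₂ : su n) :
    inner ℝ (adTangent (V * ρ * star V) ⟨V * Ω₁ * star V, conj_mem_su hV Ω₁.2⟩)
        (adTangent (V * ρ * star V) ⟨V * Ω₂ * star V, conj_mem_su hV Ω₂.2⟩)
      = inner ℝ (adTangent ρ Ω₁) (adTangent ρ Ω₂) := by
  obtain ⟨a₁, ha₁, b₁, hb₁, h₁⟩ := exists_decomp ρ Ω₁.2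
  obtain ⟨a₂, ha₂, b₂, hb₂, h₂⟩ := exists_decomp ρ Ω₂.2
  have hadd : ∀ {a b Ω : Mat n}, a + b = Ω →
      V * a * star V + V * b * star V = V * Ω * star V := by
    rintro a b _ rfl
    rw [mul_add, add_mul]
  rw [inner_adTangent ρ Ω₁ Ω₂ ha₁ hb₁ h₁ ha₂ hb₂ h₂,
    inner_adTangent _ _ _ (conj_mem_stab hV ha₁) (conj_mem_pSpace hV ρ hb₁)
      (hadd h₁) (conj_mem_stab hV ha₂) (conj_mem_pSpace hV ρ hb₂)
      (hadd h₂)]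
  exact hs_conj hV b₁ b₂

lemma inner_eq_inner_of_conj {V ρ σ : Mat n} (hV : star V * V = 1) (hσ : σ = V * ρ * star V)
    {ξ₁ ξ₂ : TangentVec ρ} {η₁ η₂ : TangentVec σ} (h₁ : incl σ η₁ = V * incl ρ ξ₁ * star V)
    (h₂ : incl σ η₂ = V * incl ρ ξ₂ * star V) : inner ℝ η₁ η₂ = inner ℝ ξ₁ ξ₂ := by
  subst hσ
  obtain ⟨Ω₁, rfl⟩ := exists_adTangent_eq ξ₁
  obtain ⟨Ω₂, rfl⟩ := exists_adTangent_eq ξ₂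
  rw [← inner_adTangent_conj hV, incl_injective _ (h₁.trans (incl_adTangent_conj hV ρ Ω₁).symm),
    incl_injective _ (h₂.trans (incl_adTangent_conj hV ρ Ω₂).symm)]

lemma lie_mem_tangentSubmodule {X : Mat n} (hX : X ∈ skewAdjoint (Mat n)) (ρ : Mat n) :
    ⁅X, ρ⁆ ∈ tangentSubmodule ρ := by
  -- Subtracting a scalar matrix makes `X` traceless and does not change the commutator.
  set c : ℂ := X.trace / n with hc
  have hcstar : star c = -c := by
    rw [hc, star_div₀, ← Matrix.trace_conjTranspose, ← Matrix.star_eq_conjTranspose,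
      skewAdjoint.mem_iff.1 hX, Matrix.trace_neg, star_natCast, neg_div]
  refine ⟨c • 1 - X, ⟨?_, ?_⟩, ?_⟩
  · rw [Matrix.conjTranspose_sub, Matrix.conjTranspose_smul, Matrix.conjTranspose_one, hcstar,
      ← Matrix.star_eq_conjTranspose, skewAdjoint.mem_iff.1 hX, neg_smul, neg_sub_neg, neg_sub]
  · rcases n.eq_zero_or_pos with rfl | hn
    · simp
    · have hn' : (n : ℂ) ≠ 0 := Nat.cast_ne_zero.2 hn.ne'
      simp [hc, hn']
  · rw [ad_apply]
    simp only [Ring.lie_def, mul_sub, sub_mul, mul_smul_comm, smul_mul_assoc, mul_one, one_mul]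
    abel

lemma conj_mem_orbit {V : Mat n} (hV : V ∈ unitary (Mat n)) (ρ₀ : Mat n) :
    V * ρ₀ * star V ∈ orbit ρ₀ := by
  rcases n.eq_zero_or_pos with rfl | hn
  · exact ⟨1, one_mem _, Subsingleton.elim _ _⟩
  -- An `n`-th root of `(det V)⁻¹` is a phase that moves `V` into `SU(n)` and cancels in `V ρ₀ V†`.
  have hdet : star V.det * V.det = 1 := (Matrix.det_of_mem_unitary hV).1
  obtain ⟨c, hc⟩ := IsAlgClosed.exists_pow_nat_eq (star V.det) hn
  have hcnorm : ‖c‖ = 1 := by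
    rw [← pow_eq_one_iff_of_nonneg (norm_nonneg c) hn.ne', ← norm_pow, hc, norm_star]
    exact CStarRing.norm_of_mem_unitary (Matrix.det_of_mem_unitary hV)
  have hcc : star c * c = 1 := by
    rw [Complex.star_def, Complex.conj_mul', hcnorm, Complex.ofReal_one, one_pow]
  refine ⟨c • V, Matrix.mem_specialUnitaryGroup_iff.2 ⟨Matrix.mem_unitaryGroup_iff'.2 ?_, ?_⟩, ?_⟩
  · rw [star_smul, smul_mul_smul_comm, hcc, hV.1, one_smul]
  · rw [Matrix.det_smul, Fintype.card_fin, hc, hdet]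
  · rw [← Matrix.star_eq_conjTranspose, star_smul, smul_mul_assoc, smul_mul_smul_comm, mul_comm c,
      hcc, one_smul]

end TangentSpace

section AdjointVector

open scoped Matrix.Norms.L2Operator

attribute [local instance] realNormedAlgebra

variable {n : ℕ} {H₀ H₁ : su n} {T : ℝ} {ρ₀ : Mat n} {u : Control T}
  {z : TangentVec (endpoint H₀ H₁ ρ₀ u)}

lemma endpoint_mem_orbit (hT : 0 ≤ T) (ρ₀ : Mat n) (u : Control T) :
    endpoint H₀ H₁ ρ₀ u ∈ orbit ρ₀ := by
  rw [endpoint, trajectory_eq_conj ρ₀ u ⟨hT, le_rfl⟩]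
  exact conj_mem_orbit (propagator_mem_unitary ⟨hT, le_rfl⟩ u) ρ₀

lemma isAdjointVector_iff (hT : 0 ≤ T) {q : ∀ t, TangentVec (trajectory H₀ H₁ ρ₀ u t)} :
    IsAdjointVector H₀ H₁ ρ₀ u z q ↔ incl _ (q T) = incl _ z ∧
      IsPrimitiveOn (fun t => incl _ (q t)) (fun t => ⁅hamiltonian H₀ H₁ u t, incl _ (q t)⁆) 0 T :=
  isSolution_iff ⟨hT, le_rfl⟩

lemma IsAdjointVector.incl_eq_conj {q : ∀ t, TangentVec (trajectory H₀ H₁ ρ₀ u t)}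
    (hq : IsAdjointVector H₀ H₁ ρ₀ u z q) {t : ℝ} (ht : t ∈ Icc 0 T) :
    incl _ (q t) = transition H₀ H₁ u t T * incl _ z * star (transition H₀ H₁ u t T) := by
  have hT := ht.1.trans ht.2
  obtain ⟨hqT, hq'⟩ := (isAdjointVector_iff hT).1 hq
  rw [(isPrimitiveOn_transition hT u).eq_conj_of_lie (hamiltonian_mem_skewAdjoint u)
    right_mem_uIcc (transition_self ⟨hT, le_rfl⟩ u) hq' (Icc_subset_uIcc ht), hqT]

lemma exists_isAdjointVector (hT : 0 ≤ T) (z : TangentVec (endpoint H₀ H₁ ρ₀ u)) :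
    ∃ q, IsAdjointVector H₀ H₁ ρ₀ u z q := by
  have hq : ∀ t, ∃ q : TangentVec (trajectory H₀ H₁ ρ₀ u t), t ∈ Icc 0 T →
      incl _ q = transition H₀ H₁ u t T * incl _ z * star (transition H₀ H₁ u t T) := by
    intro t
    by_cases ht : t ∈ Icc 0 T
    · obtain ⟨q, hq⟩ := exists_incl_eq_conj (transition_mem_unitary ⟨hT, le_rfl⟩ ht u).1
        (trajectory_eq_transition_conj ρ₀ u ht) z
      exact ⟨q, fun _ => hq⟩
    · exact ⟨0, fun h => absurd h ht⟩
  choose q hq using hq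
  have hEq : EqOn (fun t => transition H₀ H₁ u t T * incl _ z * star (transition H₀ H₁ u t T))
      (fun t => incl _ (q t)) (uIcc 0 T) := fun t ht => (hq t (uIcc_of_le hT ▸ ht)).symm
  refine ⟨q, (isAdjointVector_iff hT).2 ⟨?_, ((isPrimitiveOn_transition hT u).conj_const
    (hamiltonian_mem_skewAdjoint u) (incl _ z)).congr hEq fun t ht => ?_⟩⟩
  · rw [hq T ⟨hT, le_rfl⟩, transition_self ⟨hT, le_rfl⟩, star_one, one_mul, mul_one]
  · exact congrArg (⁅hamiltonian H₀ H₁ u t, ·⁆) (hEq ht)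

lemma isAdjointVector_adjointVector (hT : 0 ≤ T) (z : TangentVec (endpoint H₀ H₁ ρ₀ u)) :
    IsAdjointVector H₀ H₁ ρ₀ u z (adjointVector H₀ H₁ ρ₀ u z) :=
  Classical.epsilon_spec (exists_isAdjointVector hT z)

lemma IsAdjointVector.eq_adjointVector {q : ∀ t, TangentVec (trajectory H₀ H₁ ρ₀ u t)}
    (hq : IsAdjointVector H₀ H₁ ρ₀ u z q) {t : ℝ} (ht : t ∈ Icc 0 T) :
    q t = adjointVector H₀ H₁ ρ₀ u z t :=
  incl_injective _ <| (hq.incl_eq_conj ht).trans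
    ((isAdjointVector_adjointVector (ht.1.trans ht.2) z).incl_eq_conj ht).symm

end AdjointVector

section NormBounds

variable {R : Type*}

lemma norm_lie_le [NormedRing R] (A B : R) : ‖⁅A, B⁆‖ ≤ 2 * ‖A‖ * ‖B‖ :=
  calc ‖⁅A, B⁆‖ ≤ ‖A * B‖ + ‖B * A‖ := norm_sub_le _ _
    _ ≤ ‖A‖ * ‖B‖ + ‖B‖ * ‖A‖ := add_le_add (norm_mul_le _ _) (norm_mul_le _ _)
    _ = 2 * ‖A‖ * ‖B‖ := by ring

lemma lipschitzWith_lie [NormedRing R] (A : R) : LipschitzWith (2 * ‖A‖₊) fun B : R => ⁅A, B⁆ :=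
  LipschitzWith.of_dist_le_mul fun B C => by
    have h : ⁅A, B⁆ - ⁅A, C⁆ = ⁅A, B - C⁆ := by simp only [Ring.lie_def]; noncomm_ring
    simpa only [dist_eq_norm, h, NNReal.coe_mul, NNReal.coe_ofNat, coe_nnnorm] using
      norm_lie_le A (B - C)

lemma norm_conj [NormedRing R] [StarRing R] [CStarRing R] {V : R} (hV : V ∈ unitary R) (A : R) :
    ‖V * A * star V‖ = ‖A‖ := by
  rw [CStarRing.norm_mul_mem_unitary _ (Unitary.star_mem hV), CStarRing.norm_mem_unitary_mul _ hV]

lemma norm_star_conj [NormedRing R] [StarRing R] [CStarRing R] {V : R} (hV : V ∈ unitary R)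
    (A : R) : ‖star V * A * V‖ = ‖A‖ := by
  simpa only [star_star] using norm_conj (Unitary.star_mem hV) A

end NormBounds

lemma hasFDerivAt_of_norm_sub_le {E F : Type*} [NormedAddCommGroup E] [NormedSpace ℝ E]
    [NormedAddCommGroup F] [NormedSpace ℝ F] {f : E → F} {f' : E →L[ℝ] F} {x : E} (C : ℝ)
    (h : ∀ v, ‖f (x + v) - f x - f' v‖ ≤ C * ‖v‖ ^ 2) : HasFDerivAt f f' x := by
  refine hasFDerivAt_iff_isLittleO_nhds_zero.2 (Asymptotics.IsBigO.trans_isLittleO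
    (.of_bound C (.of_forall fun v => ?_)) (Asymptotics.isLittleO_norm_pow_id one_lt_two))
  rw [Real.norm_of_nonneg (by positivity)]
  exact h v

lemma exists_clm_eq_integral_smul {α F : Type*} [MeasurableSpace α] {μ : Measure α}
    [NormedAddCommGroup F] [NormedSpace ℝ F] [CompleteSpace F] {p q : ℝ≥0∞} [Fact (1 ≤ p)]
    [Fact (1 ≤ q)] [p.HolderConjugate q] {g : α → F} (hg : MemLp g q μ) :
    ∃ D : Lp ℝ p μ →L[ℝ] F, ∀ v, D v = ∫ x, v x • g x ∂μ := by
  refine ⟨((ContinuousLinearMap.lsmul ℝ ℝ).lpPairing μ p q).flip (hg.toLp g), fun v => ?_⟩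
  rw [ContinuousLinearMap.flip_apply, ContinuousLinearMap.lpPairing_eq_integral]
  refine integral_congr_ae (hg.coeFn_toLp.mono fun x hx => ?_)
  simp only [hx, ContinuousLinearMap.lsmul_apply]

lemma memLp_of_continuousOn {E : Type*} [NormedAddCommGroup E] {a b : ℝ} {g : ℝ → E} {p : ℝ≥0∞}
    (hg : ContinuousOn g (Icc a b)) : MemLp g p (volume.restrict (Icc a b)) := by
  obtain ⟨C, hC⟩ := isCompact_Icc.exists_bound_of_continuousOn hg
  exact MemLp.of_bound (hg.aestronglyMeasurable measurableSet_Icc) C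
    (ae_restrict_of_forall_mem measurableSet_Icc hC)

section Differential

open scoped Matrix.Norms.L2Operator

attribute [local instance] realNormedAlgebra

variable {n : ℕ} {H₀ H₁ : su n} {T : ℝ}

/-- The control Hamiltonian `H₁` in the interaction picture of `u`, that is, `V(t)† H₁ V(t)` where
`V(t) = U(t) U(T)†`. Normalizing `V` at time `T` makes this an operator at the end-point. -/
noncomputable def interactionHamiltonian (H₀ H₁ : su n) (u : Control T) (t : ℝ) : Mat n :=
  star (transition H₀ H₁ u t T) * (H₁ : Mat n) * transition H₀ H₁ u t T

/-- The trajectory of the control `w` in the interaction picture of `u`, normalized at time `T`. -/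
noncomputable def interactionTrajectory (H₀ H₁ : su n) (ρ₀ : Mat n) (u w : Control T) (t : ℝ) :
    Mat n :=
  star (transition H₀ H₁ u t T) * trajectory H₀ H₁ ρ₀ w t * transition H₀ H₁ u t T

lemma interactionHamiltonian_mem_skewAdjoint (u : Control T) (t : ℝ) :
    interactionHamiltonian H₀ H₁ u t ∈ skewAdjoint (Mat n) :=
  skewAdjoint.conjugate' (x := (H₁ : Mat n)) H₁.2.1 _

lemma norm_interactionHamiltonian (u : Control T) {t : ℝ} (ht : t ∈ Icc 0 T) :
    ‖interactionHamiltonian H₀ H₁ u t‖ = ‖(H₁ : Mat n)‖ :=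
  norm_star_conj (transition_mem_unitary ⟨ht.1.trans ht.2, le_rfl⟩ ht u) _

lemma continuousOn_interactionHamiltonian (hT : 0 ≤ T) (u : Control T) :
    ContinuousOn (interactionHamiltonian H₀ H₁ u) (Icc 0 T) := by
  have hV : ContinuousOn (fun t => transition H₀ H₁ u t T) (Icc 0 T) := by
    simpa only [uIcc_of_le hT] using (isPrimitiveOn_transition hT u).continuousOn
  exact (hV.star.mul continuousOn_const).mul hV

lemma interactionTrajectory_zero (hT : 0 ≤ T) (ρ₀ : Mat n) (u w : Control T) :
    interactionTrajectory H₀ H₁ ρ₀ u w 0 = endpoint H₀ H₁ ρ₀ u := by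
  have h₀ : (0 : ℝ) ∈ Icc 0 T := ⟨le_rfl, hT⟩
  have h : trajectory H₀ H₁ ρ₀ w 0 = trajectory H₀ H₁ ρ₀ u 0 :=
    (trajectory_zero hT ρ₀ w).trans (trajectory_zero hT ρ₀ u).symm
  rw [interactionTrajectory, h, trajectory_eq_transition_conj ρ₀ u h₀,
    ← Matrix.star_eq_conjTranspose,
    star_conj_conj (transition_mem_unitary ⟨hT, le_rfl⟩ h₀ u).1]

lemma interactionTrajectory_terminal (hT : 0 ≤ T) (ρ₀ : Mat n) (u w : Control T) :
    interactionTrajectory H₀ H₁ ρ₀ u w T = endpoint H₀ H₁ ρ₀ w := by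
  rw [interactionTrajectory, transition_self ⟨hT, le_rfl⟩ u, star_one, one_mul, mul_one, endpoint]

lemma norm_interactionTrajectory (ρ₀ : Mat n) (u w : Control T) {t : ℝ} (ht : t ∈ Icc 0 T) :
    ‖interactionTrajectory H₀ H₁ ρ₀ u w t‖ = ‖ρ₀‖ := by
  rw [interactionTrajectory,
    norm_star_conj (transition_mem_unitary ⟨ht.1.trans ht.2, le_rfl⟩ ht u),
    trajectory_eq_conj ρ₀ w ht]
  exact norm_conj (propagator_mem_unitary ht w) ρ₀

lemma isPrimitiveOn_interactionTrajectory (hT : 0 ≤ T) (ρ₀ : Mat n) (u v : Control T) :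
    IsPrimitiveOn (interactionTrajectory H₀ H₁ ρ₀ u (u + v))
      (fun t => v t • ⁅interactionHamiltonian H₀ H₁ u t,
        interactionTrajectory H₀ H₁ ρ₀ u (u + v) t⁆) 0 T := by
  refine (isPrimitiveOn_transition hT u).interaction_picture (hamiltonian_mem_skewAdjoint u)
    (fun t ht => transition_mem_unitary ⟨hT, le_rfl⟩ (uIcc_of_le hT ▸ ht) u)
    ((isPrimitiveOn_trajectory hT ρ₀ (u + v)).congr_ae ?_)
  rw [uIoc_of_le hT]
  filter_upwards [ae_restrict_of_ae_restrict_of_subset Ioc_subset_Icc_self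
    (hamiltonian_add_ae u v)] with t ht
  rw [ht]

/-- The control field `[H₁, ρ(t)]`, transported to the end-point by conjugation with `V(t)†`. -/
noncomputable def transportedField (H₀ H₁ : su n) (ρ₀ : Mat n) (u : Control T) (t : ℝ) :
    TangentVec (endpoint H₀ H₁ ρ₀ u) :=
  ⟨⁅interactionHamiltonian H₀ H₁ u t, endpoint H₀ H₁ ρ₀ u⁆,
    lie_mem_tangentSubmodule (interactionHamiltonian_mem_skewAdjoint u t) _⟩

lemma incl_transportedField (ρ₀ : Mat n) (u : Control T) (t : ℝ) :
    incl _ (transportedField H₀ H₁ ρ₀ u t)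
      = ⁅interactionHamiltonian H₀ H₁ u t, endpoint H₀ H₁ ρ₀ u⁆ := rfl

lemma continuousOn_transportedField (hT : 0 ≤ T) (ρ₀ : Mat n) (u : Control T) :
    ContinuousOn (transportedField H₀ H₁ ρ₀ u) (Icc 0 T) := by
  have hH := continuousOn_interactionHamiltonian (H₀ := H₀) (H₁ := H₁) hT u
  rw [(LinearMap.isClosedEmbedding_of_injective (f := (incl (endpoint H₀ H₁ ρ₀ u)).toLinearMap)
    (LinearMap.ker_eq_bot.2 (incl_injective _))).isInducing.continuousOn_iff]
  exact (hH.mul continuousOn_const).sub (continuousOn_const.mul hH)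

lemma memLp_transportedField (hT : 0 ≤ T) (ρ₀ : Mat n) (u : Control T) :
    MemLp (transportedField H₀ H₁ ρ₀ u) 2 (volume.restrict (Icc 0 T)) :=
  memLp_of_continuousOn (continuousOn_transportedField hT ρ₀ u)

lemma integrable_smul_transportedField (hT : 0 ≤ T) (ρ₀ : Mat n) (u v : Control T) :
    Integrable (fun t => v t • transportedField H₀ H₁ ρ₀ u t) (volume.restrict (Icc 0 T)) :=
  memLp_one_iff_integrable.1 ((memLp_transportedField hT ρ₀ u).smul (Lp.memLp v))

lemma incl_integral_smul_transportedField (hT : 0 ≤ T) (ρ₀ : Mat n) (u v : Control T) :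
    incl _ (∫ t in Icc 0 T, v t • transportedField H₀ H₁ ρ₀ u t)
      = ∫ t in 0..T, v t • ⁅interactionHamiltonian H₀ H₁ u t, endpoint H₀ H₁ ρ₀ u⁆ := by
  rw [← ContinuousLinearMap.integral_comp_comm _ (integrable_smul_transportedField hT ρ₀ u v),
    intervalIntegral.integral_of_le hT, integral_Icc_eq_integral_Ioc]
  simp only [map_smul, incl_transportedField]

lemma norm_endpoint_add_sub_le (hT : 0 ≤ T) (ρ₀ : Mat n) (u v : Control T) :
    ‖endpoint H₀ H₁ ρ₀ (u + v) - endpoint H₀ H₁ ρ₀ u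
        - incl _ (∫ t in Icc 0 T, v t • transportedField H₀ H₁ ρ₀ u t)‖
      ≤ 2 * ‖(H₁ : Mat n)‖ * (2 * ‖(H₁ : Mat n)‖ * ‖ρ₀‖) * (∫ t in Icc 0 T, ‖v t‖) ^ 2 := by
  have hint : IntervalIntegrable
      (fun t => v t • ⁅interactionHamiltonian H₀ H₁ u t, endpoint H₀ H₁ ρ₀ u⁆) volume 0 T := by
    rw [intervalIntegrable_iff_integrableOn_Icc_of_le hT]
    exact (incl _).integrable_comp (integrable_smul_transportedField hT ρ₀ u v)
  have h := (isPrimitiveOn_interactionTrajectory hT ρ₀ u v).norm_sub_sub_integral_le hT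
    (f := fun t Y => ⁅interactionHamiltonian H₀ H₁ u t, Y⁆) (K := 2 * ‖(H₁ : Mat n)‖₊)
    (M := 2 * ‖(H₁ : Mat n)‖ * ‖ρ₀‖) (intervalIntegrable_control hT v)
    (fun t ht => ?_) (fun t ht => ?_) (by simpa only [interactionTrajectory_zero hT] using hint)
  · rwa [interactionTrajectory_zero hT, interactionTrajectory_terminal hT,
      ← incl_integral_smul_transportedField hT, NNReal.coe_mul, NNReal.coe_ofNat, coe_nnnorm,
      intervalIntegral.integral_of_le hT, ← integral_Icc_eq_integral_Ioc] at h
  · rw [show ‖(H₁ : Mat n)‖₊ = ‖interactionHamiltonian H₀ H₁ u t‖₊ from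
      Subtype.ext (norm_interactionHamiltonian u ht).symm]
    exact lipschitzWith_lie _
  · rw [← norm_interactionTrajectory ρ₀ u (u + v) ht, ← norm_interactionHamiltonian u ht]
    exact norm_lie_le _ _

lemma exists_isDEnd (hT : 0 ≤ T) (ρ₀ : Mat n) (u : Control T) : ∃ D, IsDEnd H₀ H₁ ρ₀ u D ∧
    ∀ v, D v = ∫ t in Icc 0 T, v t • transportedField H₀ H₁ ρ₀ u t := by
  obtain ⟨D, hD⟩ := exists_clm_eq_integral_smul (p := 2) (memLp_transportedField hT ρ₀ u)
  refine ⟨D, hasFDerivAt_of_norm_sub_le (2 * ‖(H₁ : Mat n)‖ * (2 * ‖(H₁ : Mat n)‖ * ‖ρ₀‖) *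
    ((volume.restrict (Icc 0 T)).real univ ^ (1 - 1 / (2 : ℝ≥0∞).toReal)) ^ 2) fun v => ?_, hD⟩
  rw [ContinuousLinearMap.comp_apply, hD]
  grw [norm_endpoint_add_sub_le hT ρ₀ u v, integral_norm_le_mul_norm one_le_two v]
  exact le_of_eq (by ring)

lemma IsDEnd.unique {ρ₀ : Mat n} {u : Control T}
    {D D' : Control T →L[ℝ] TangentVec (endpoint H₀ H₁ ρ₀ u)}
    (hD : IsDEnd H₀ H₁ ρ₀ u D) (hD' : IsDEnd H₀ H₁ ρ₀ u D') : D = D' :=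
  ContinuousLinearMap.ext fun v =>
    incl_injective _ (DFunLike.congr_fun (HasFDerivAt.unique hD hD') v)

lemma isDEnd_dEnd (hT : 0 ≤ T) (ρ₀ : Mat n) (u : Control T) :
    IsDEnd H₀ H₁ ρ₀ u (dEnd H₀ H₁ ρ₀ u) :=
  Classical.epsilon_spec ((exists_isDEnd hT ρ₀ u).imp fun _ h => h.1)

lemma dEnd_apply (hT : 0 ≤ T) (ρ₀ : Mat n) (u v : Control T) :
    dEnd H₀ H₁ ρ₀ u v = ∫ t in Icc 0 T, v t • transportedField H₀ H₁ ρ₀ u t := by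
  obtain ⟨D, hD, hDv⟩ := exists_isDEnd (H₀ := H₀) (H₁ := H₁) hT ρ₀ u
  rw [(isDEnd_dEnd hT ρ₀ u).unique hD, hDv]

end Differential

lemma mem_ker_adjoint_iff {E F : Type*} [NormedAddCommGroup E] [InnerProductSpace ℝ E]
    [CompleteSpace E] [NormedAddCommGroup F] [InnerProductSpace ℝ F] [CompleteSpace F]
    (A : E →L[ℝ] F) (y : F) :
    y ∈ LinearMap.ker (ContinuousLinearMap.adjoint A : F →ₗ[ℝ] E) ↔ ∀ x, inner ℝ y (A x) = 0 := by
  rw [← ContinuousLinearMap.orthogonal_range, Submodule.mem_orthogonal']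
  exact Set.forall_mem_range

lemma ae_eq_zero_iff_forall_integral_mul_eq_zero {α : Type*} [MeasurableSpace α] {μ : Measure α}
    {g : α → ℝ} (hg : MemLp g 2 μ) :
    (∀ᵐ x ∂μ, g x = 0) ↔ ∀ v : Lp ℝ 2 μ, ∫ x, v x * g x ∂μ = 0 := by
  have hinner : ∀ v : Lp ℝ 2 μ, inner ℝ v (hg.toLp g) = ∫ x, v x * g x ∂μ := fun v => by
    rw [L2.inner_def]
    refine integral_congr_ae (hg.coeFn_toLp.mono fun x hx => ?_)
    simp only [hx, RCLike.inner_apply, conj_trivial, mul_comm]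
  have hzero : (∀ᵐ x ∂μ, g x = 0) ↔ hg.toLp g = 0 := by
    rw [Lp.eq_zero_iff_ae_eq_zero]
    exact Filter.eventually_congr (hg.coeFn_toLp.mono fun x hx => by rw [hx, Pi.zero_apply])
  simp only [hzero, ← hinner]
  exact ⟨fun h v => by rw [h, inner_zero_right], fun h => inner_self_eq_zero.1 (h _)⟩

section Trace

variable {m R : Type*} [Fintype m] [CommRing R]

lemma trace_lie_mul (A B C : Matrix m m R) : (⁅A, B⁆ * C).trace = (⁅B, C⁆ * A).trace := by
  simp only [Ring.lie_def, sub_mul, Matrix.trace_sub]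
  rw [Matrix.trace_mul_cycle B A C, Matrix.trace_mul_cycle B C A]

lemma star_trace_lie_mul [StarRing R] {A B X : Matrix m m R} (hA : A.IsHermitian)
    (hB : B.IsHermitian) (hX : X ∈ skewAdjoint (Matrix m m R)) :
    star (⁅A, B⁆ * X).trace = (⁅A, B⁆ * X).trace := by
  have hlie : ⁅A, B⁆ᴴ = -⁅A, B⁆ := by
    simp only [Ring.lie_def, Matrix.conjTranspose_sub, Matrix.conjTranspose_mul, hA.eq, hB.eq,
      neg_sub]
  rw [← Matrix.trace_conjTranspose, Matrix.conjTranspose_mul, hlie,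
    ← Matrix.star_eq_conjTranspose, skewAdjoint.mem_iff.1 hX, neg_mul_neg, Matrix.trace_mul_comm]

end Trace

section Switching

variable {n : ℕ} {H₀ H₁ : su n} {T : ℝ} {ρ₀ : Mat n} {u : Control T}

lemma incl_controlField_trajectory {t : ℝ} (ht : t ∈ Icc 0 T) :
    incl _ (controlField H₁ (trajectory H₀ H₁ ρ₀ u t)) = transition H₀ H₁ u t T *
      incl _ (transportedField H₀ H₁ ρ₀ u t) * star (transition H₀ H₁ u t T) := by
  have hV := transition_mem_unitary (H₀ := H₀) (H₁ := H₁) ⟨ht.1.trans ht.2, le_rfl⟩ ht u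
  have hH₁ := star_conj_conj (V := star (transition H₀ H₁ u t T)) (by simpa using hV.2) (H₁ : Mat n)
  rw [star_star] at hH₁
  rw [incl_transportedField, ← conj_lie_conj hV.1, interactionHamiltonian, hH₁,
    Matrix.star_eq_conjTranspose, ← trajectory_eq_transition_conj ρ₀ u ht]
  rfl

lemma switching_eq_inner_transportedField (z : TangentVec (endpoint H₀ H₁ ρ₀ u)) {t : ℝ}
    (ht : t ∈ Icc 0 T) :
    switching H₀ H₁ ρ₀ u z t = inner ℝ z (transportedField H₀ H₁ ρ₀ u t) := by
  have hT := ht.1.trans ht.2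
  exact inner_eq_inner_of_conj (transition_mem_unitary ⟨hT, le_rfl⟩ ht u).1
    (trajectory_eq_transition_conj ρ₀ u ht)
    ((isAdjointVector_adjointVector hT z).incl_eq_conj ht) (incl_controlField_trajectory ht)

lemma ae_switching_eq_zero_iff (z : TangentVec (endpoint H₀ H₁ ρ₀ u)) :
    (∀ᵐ t ∂volume.restrict (Icc 0 T), switching H₀ H₁ ρ₀ u z t = 0) ↔
      ∀ᵐ t ∂volume.restrict (Icc 0 T), inner ℝ z (transportedField H₀ H₁ ρ₀ u t) = 0 :=
  Filter.eventually_congr <| ae_restrict_of_forall_mem measurableSet_Icc fun t ht => by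
    rw [switching_eq_inner_transportedField z ht]

lemma inner_dEnd_eq_integral (hT : 0 ≤ T) (z : TangentVec (endpoint H₀ H₁ ρ₀ u))
    (v : Control T) : inner ℝ z (dEnd H₀ H₁ ρ₀ u v)
      = ∫ t in Icc 0 T, v t * inner ℝ z (transportedField H₀ H₁ ρ₀ u t) := by
  simp only [dEnd_apply hT, ← integral_inner (integrable_smul_transportedField hT ρ₀ u v),
    real_inner_smul_right]

lemma ae_switching_eq_zero_iff_forall_inner_dEnd (hT : 0 ≤ T)
    (z : TangentVec (endpoint H₀ H₁ ρ₀ u)) :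
    (∀ᵐ t ∂volume.restrict (Icc 0 T), switching H₀ H₁ ρ₀ u z t = 0) ↔
      ∀ v, inner ℝ z (dEnd H₀ H₁ ρ₀ u v) = 0 := by
  simp only [ae_switching_eq_zero_iff, inner_dEnd_eq_integral hT]
  exact ae_eq_zero_iff_forall_integral_mul_eq_zero
    ((memLp_transportedField hT ρ₀ u).const_inner z)

lemma ae_switching_eq_zero_iff_forall_mem_Icc (hT : 0 < T)
    (z : TangentVec (endpoint H₀ H₁ ρ₀ u)) :
    (∀ᵐ t ∂volume.restrict (Icc 0 T), switching H₀ H₁ ρ₀ u z t = 0) ↔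
      ∀ t ∈ Icc 0 T, inner ℝ z (transportedField H₀ H₁ ρ₀ u t) = 0 := by
  rw [ae_switching_eq_zero_iff]
  exact ⟨fun h => Measure.eqOn_Icc_of_ae_eq volume hT.ne h
    (ContinuousOn.inner (𝕜 := ℝ) continuousOn_const
      (continuousOn_transportedField hT.le ρ₀ u)) continuousOn_const,
    ae_restrict_of_forall_mem measurableSet_Icc⟩

end Switching

section Cost

open scoped Matrix.Norms.L2Operator

attribute [local instance] realNormedAlgebra

variable {n : ℕ} {H₀ H₁ : su n} {T : ℝ} {ρ₀ θ : Mat n} {u : Control T}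

lemma exists_hasFDerivAt_costOrbit (θ ρ : Mat n) : ∃ l : Mat n →L[ℝ] ℝ,
    HasFDerivAt (costOrbit θ) l ρ ∧ ∀ A, l A = costOrbit θ A := by
  let l : Mat n →ₗ[ℝ] ℝ := Complex.reLm.comp ((Matrix.traceLinearMap (Fin n) ℝ ℂ).comp
    (LinearMap.mulRight ℝ θ))
  exact ⟨l.toContinuousLinearMap, l.toContinuousLinearMap.hasFDerivAt, fun _ => rfl⟩

lemma inner_gradOrbit (θ ρ : Mat n) (ξ : TangentVec ρ) :
    inner ℝ (gradOrbit θ ρ) ξ = costOrbit θ (incl ρ ξ) := by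
  obtain ⟨l, hl, hl'⟩ := exists_hasFDerivAt_costOrbit θ ρ
  rw [gradOrbit, InnerProductSpace.toDual_symm_apply, ContinuousLinearMap.comp_apply, ← hl',
    hl.fderiv]

lemma hasGradientAt_cost (hT : 0 ≤ T) (ρ₀ θ : Mat n) (u : Control T) :
    HasGradientAt (cost H₀ H₁ ρ₀ θ) (ContinuousLinearMap.adjoint (dEnd H₀ H₁ ρ₀ u)
      (gradOrbit θ (endpoint H₀ H₁ ρ₀ u))) u := by
  obtain ⟨l, hl, hl'⟩ := exists_hasFDerivAt_costOrbit θ (endpoint H₀ H₁ ρ₀ u)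
  refine hasGradientAt_iff_hasFDerivAt.2
    ((hl.comp u (isDEnd_dEnd hT ρ₀ u)).congr_fderiv (ContinuousLinearMap.ext fun v => ?_))
  rw [InnerProductSpace.toDual_apply_apply, ContinuousLinearMap.adjoint_inner_left,
    inner_gradOrbit, ← hl']
  rfl

lemma isCriticalControl_iff_mem_ker_adjoint_dEnd (hT : 0 ≤ T) :
    IsCriticalControl H₀ H₁ ρ₀ θ u ↔ gradOrbit θ (endpoint H₀ H₁ ρ₀ u) ∈
      LinearMap.ker (ContinuousLinearMap.adjoint (dEnd H₀ H₁ ρ₀ u) :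
        TangentVec (endpoint H₀ H₁ ρ₀ u) →ₗ[ℝ] Control T) := by
  have h := hasGradientAt_cost (H₀ := H₀) (H₁ := H₁) hT ρ₀ θ u
  refine ⟨h.unique, fun hker => ?_⟩
  rwa [show ContinuousLinearMap.adjoint (dEnd H₀ H₁ ρ₀ u) (gradOrbit θ (endpoint H₀ H₁ ρ₀ u)) = 0
    from hker] at h

lemma inner_gradOrbit_transportedField (θ : Mat n) (t : ℝ) :
    inner ℝ (gradOrbit θ (endpoint H₀ H₁ ρ₀ u)) (transportedField H₀ H₁ ρ₀ u t)
      = (⁅endpoint H₀ H₁ ρ₀ u, θ⁆ * interactionHamiltonian H₀ H₁ u t).trace.re := by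
  rw [inner_gradOrbit, incl_transportedField, costOrbit, trace_lie_mul]

lemma endpoint_isHermitian (hT : 0 ≤ T) (hρ₀ : ρ₀.IsHermitian) (u : Control T) :
    (endpoint H₀ H₁ ρ₀ u).IsHermitian := by
  rw [endpoint, trajectory_eq_conj ρ₀ u ⟨hT, le_rfl⟩]
  exact Matrix.isHermitian_mul_mul_conjTranspose _ hρ₀

lemma inner_gradOrbit_transportedField_eq_zero_iff (hT : 0 ≤ T) (hρ₀ : ρ₀.IsHermitian)
    (hθ : θ.IsHermitian) (t : ℝ) :
    inner ℝ (gradOrbit θ (endpoint H₀ H₁ ρ₀ u)) (transportedField H₀ H₁ ρ₀ u t) = 0 ↔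
      (⁅endpoint H₀ H₁ ρ₀ u, θ⁆ * interactionHamiltonian H₀ H₁ u t).trace = 0 := by
  have hreal := Complex.conj_eq_iff_im.1 (star_trace_lie_mul
    (endpoint_isHermitian (H₀ := H₀) (H₁ := H₁) hT hρ₀ u) hθ
    (interactionHamiltonian_mem_skewAdjoint (H₀ := H₀) (H₁ := H₁) u t))
  rw [inner_gradOrbit_transportedField, Complex.ext_iff, hreal]
  simp only [Complex.zero_re, Complex.zero_im, and_true]

lemma trace_lie_endpoint_mul_interactionHamiltonian (hT : 0 ≤ T) (ρ₀ θ : Mat n) (u : Control T)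
    (t : ℝ) :
    (⁅endpoint H₀ H₁ ρ₀ u, θ⁆ * interactionHamiltonian H₀ H₁ u t).trace
      = (⁅ρ₀, (propagator H₀ H₁ u T)ᴴ * θ * propagator H₀ H₁ u T⁆ *
        ((propagator H₀ H₁ u t)ᴴ * (H₁ : Mat n) * propagator H₀ H₁ u t)).trace := by
  have hTT : T ∈ Icc 0 T := ⟨hT, le_rfl⟩
  have hU := propagator_mem_unitary (H₀ := H₀) (H₁ := H₁) hTT u
  have hH : interactionHamiltonian H₀ H₁ u t = propagator H₀ H₁ u T *
      ((propagator H₀ H₁ u t)ᴴ * (H₁ : Mat n) * propagator H₀ H₁ u t) *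
      star (propagator H₀ H₁ u T) := by
    simp only [interactionHamiltonian, transition, Matrix.star_eq_conjTranspose,
      Matrix.conjTranspose_mul, Matrix.conjTranspose_conjTranspose, mul_assoc]
  have hθ := star_conj_conj (V := star (propagator H₀ H₁ u T)) (by simpa using hU.2) θ
  rw [star_star] at hθ
  have htrace := trace_conj_mul_conj hU.1
    ⁅ρ₀, star (propagator H₀ H₁ u T) * θ * propagator H₀ H₁ u T⁆
    ((propagator H₀ H₁ u t)ᴴ * (H₁ : Mat n) * propagator H₀ H₁ u t)
  rw [← conj_lie_conj hU.1, hθ] at htrace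
  rwa [hH, endpoint, trajectory_eq_conj ρ₀ u hTT]

end Cost

end QuantumControl

open QuantumControl in
theorem mainTheorem8 {n : ℕ} (H₀ H₁ : QuantumControl.su n) (ρ₀ θ : Matrix (Fin n) (Fin n) ℂ)
    (hρ₀ : ρ₀.IsHermitian) (hθ : θ.IsHermitian) (T : ℝ) (hT : 0 < T)
    (u : QuantumControl.Control T) :
    -- the trajectory, the propagator, the differential of the end-point map and the adjoint
    -- vectors exist and are uniquely determined on [0,T]
    (QuantumControl.IsPropagator H₀ H₁ u (QuantumControl.propagator H₀ H₁ u) ∧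
      ∀ V, QuantumControl.IsPropagator H₀ H₁ u V →
        Set.EqOn V (QuantumControl.propagator H₀ H₁ u) (Set.Icc 0 T)) ∧
    (QuantumControl.IsTrajectory H₀ H₁ ρ₀ u (QuantumControl.trajectory H₀ H₁ ρ₀ u) ∧
      ∀ σ, QuantumControl.IsTrajectory H₀ H₁ ρ₀ u σ →
        Set.EqOn σ (QuantumControl.trajectory H₀ H₁ ρ₀ u) (Set.Icc 0 T)) ∧
    QuantumControl.endpoint H₀ H₁ ρ₀ u ∈ QuantumControl.orbit ρ₀ ∧
    (QuantumControl.IsDEnd H₀ H₁ ρ₀ u (QuantumControl.dEnd H₀ H₁ ρ₀ u) ∧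
      ∀ D, QuantumControl.IsDEnd H₀ H₁ ρ₀ u D → D = QuantumControl.dEnd H₀ H₁ ρ₀ u) ∧
    (∀ z : QuantumControl.TangentVec (QuantumControl.endpoint H₀ H₁ ρ₀ u),
      QuantumControl.IsAdjointVector H₀ H₁ ρ₀ u z (QuantumControl.adjointVector H₀ H₁ ρ₀ u z) ∧
      ∀ q, QuantumControl.IsAdjointVector H₀ H₁ ρ₀ u z q →
        ∀ t ∈ Set.Icc 0 T, q t = QuantumControl.adjointVector H₀ H₁ ρ₀ u z t) ∧
    -- the characterizations of critical points
    List.TFAE [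
      QuantumControl.IsCriticalControl H₀ H₁ ρ₀ θ u,
      QuantumControl.gradOrbit θ (QuantumControl.endpoint H₀ H₁ ρ₀ u) ∈
        LinearMap.ker (ContinuousLinearMap.adjoint (QuantumControl.dEnd H₀ H₁ ρ₀ u) :
          QuantumControl.TangentVec (QuantumControl.endpoint H₀ H₁ ρ₀ u) →ₗ[ℝ]
            QuantumControl.Control T),
      ∀ v : QuantumControl.Control T,
        inner ℝ (QuantumControl.gradOrbit θ (QuantumControl.endpoint H₀ H₁ ρ₀ u))
          (QuantumControl.dEnd H₀ H₁ ρ₀ u v) = 0,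
      ∀ᵐ t ∂(MeasureTheory.volume.restrict (Set.Icc 0 T)),
        QuantumControl.switching H₀ H₁ ρ₀ u
          (QuantumControl.gradOrbit θ (QuantumControl.endpoint H₀ H₁ ρ₀ u)) t = 0,
      ∀ t ∈ Set.Icc 0 T,
        (⁅ρ₀, (QuantumControl.propagator H₀ H₁ u T)ᴴ * θ * QuantumControl.propagator H₀ H₁ u T⁆ *
          ((QuantumControl.propagator H₀ H₁ u t)ᴴ * (H₁ : Matrix (Fin n) (Fin n) ℂ) *
            QuantumControl.propagator H₀ H₁ u t)).trace = 0,
      ∀ t ∈ Set.Icc 0 T,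
        (⁅QuantumControl.trajectory H₀ H₁ ρ₀ u T, θ⁆ *
          ((QuantumControl.transition H₀ H₁ u t T)ᴴ * (H₁ : Matrix (Fin n) (Fin n) ℂ) *
            QuantumControl.transition H₀ H₁ u t T)).trace = 0] := by
  have hT₀ := hT.le
  refine ⟨⟨isPropagator_propagator hT₀ u, fun V hV => hV.eqOn hT₀⟩,
    ⟨isTrajectory_trajectory hT₀ ρ₀ u, fun σ hσ => hσ.eqOn⟩, endpoint_mem_orbit hT₀ ρ₀ u,
    ⟨isDEnd_dEnd hT₀ ρ₀ u, fun D hD => hD.unique (isDEnd_dEnd hT₀ ρ₀ u)⟩,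
    fun z => ⟨isAdjointVector_adjointVector hT₀ z, fun q hq t ht => hq.eq_adjointVector ht⟩, ?_⟩
  tfae_have 1 ↔ 2 := isCriticalControl_iff_mem_ker_adjoint_dEnd hT₀
  tfae_have 2 ↔ 3 := mem_ker_adjoint_iff _ _
  tfae_have 4 ↔ 3 := ae_switching_eq_zero_iff_forall_inner_dEnd hT₀ _
  tfae_have 4 ↔ 6 := (ae_switching_eq_zero_iff_forall_mem_Icc hT _).trans <|
    forall₂_congr fun t _ => inner_gradOrbit_transportedField_eq_zero_iff hT₀ hρ₀ hθ t
  tfae_have 6 ↔ 5 := forall₂_congr fun t _ => Eq.congr_left <|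
    trace_lie_endpoint_mul_interactionHamiltonian hT₀ ρ₀ θ u t
  tfae_finish
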